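/- **Setting.** Fix $N\in\mathbb N$, a countable set $\chi\subseteq\mathbb R^N$ with $0\in\chi$, and an integer $n\ge 6$. Let $\mathcal G$ be the class of all finite simple graphs with at most $n$ nodes and node features in $\chi$. Fix a real-analytic activation function $\sigma:\mathbb R\to\mathbb R$ with two distinct finite limits at $\pm\infty$ (e.g. the logistic function or $\tanh$). A *perceptron* (MLP) has at least one hidden layer, of any width, activation $\sigma$ in the hidden layers and an affine output layer. **Tests.** The *WL test* starts with the node features as colors; in each round the new color of a node is the pair (old color, multiset of the colors of its neighbors). *$3$-WL* colors triples of nodes; the initial color of a triple is its isomorphism type (features, equality pattern, adjacency pattern), and the new color of a triple consists of its old color and, for each $j\in\{1,2,3\}$, the multiset of the colors of the triples obtained by replacing the $j$-th entry by an arbitrary node. A test *distinguishes* two graphs if after some number of rounds their multisets of colors differ. **GNNs.** *GIN*: an MLP is applied to each input feature, followed by at least one layer $x_v\mapsto \mathrm{MLP}_k\big((1+\varepsilon_k)x_v+\sum_{u\in N(v)}x_u\big)$; the output is a node coloring. *PPGN*: the input is the tensor indexed by pairs of nodes whose channels are the node features (on the diagonal, $0$ elsewhere), the adjacency matrix and the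 identity matrix, followed by at least one block $Y\mapsto[\,m_3(Y)\,|\,m_1(Y)\cdot m_2(Y)\,]$ ($m_i$ MLPs acting on the channels of each pair, $\cdot$ the channelwise matrix product, $[\cdot|\cdot]$ concatenation). The node coloring extracted from the output $Y$ is its diagonal $u\mapsto Y_{uu}$. **LGVR.** Let $G$ have node coloring $\mathcal C:V(G)\to\mathbb R^d$. Color the node of the line graph $L_G$ that belongs to an edge $\{u,v\}$ by $\phi(\{\{\mathcal C(u),\mathcal C(v)\}\})$, where $\phi(\{\{x,y\}\})=(g(x)+g(y),|g(x)-g(y)|)\in\mathbb R^{2d}$, $g(z)=z+\eta\, m(z)$, $m$ an MLP, $\eta\in\mathbb R$, $|\cdot|$ entrywise. Apply a GIN $P_1$ on $L_G$, extend the resulting coloring by $0$ to the line graph $L_{K_G}$ of the complete graph on $V(G)$, and apply there a scalar GIN $P_2$ followed by the logistic function. Let $A_{uv}\in[0,1]$ be the value obtained at $\{u,v\}$, and $A_{uu}=0$. Then $\mathrm{LGVR}(G,\mathcal C)=(\mathrm{ph}^0,\mathrm{ph}^1)$ is the pair of persistence diagrams (multisets of (birth, death) pairs, death $\infty$ for classes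 that do not die; homology over $\mathbb Z/2$) of the filtration $\{\mathrm{VR}_1^{\varepsilon}(V(G),A)\}_{\varepsilon\in[0,1/2]}$ by $1$-skeleta of Vietoris–Rips complexes. It is encoded by $\mathrm{ENC}=\mathrm{MLP}\big(\sum_{p\in\mathrm{ph}^0}S_0(p),\ \sum_{p\in\mathrm{ph}^1}S_1(p)\big)$ with MLPs $S_0,S_1$ on $\mathbb R^2$, where the death $\infty$ is entered as $1$. **Models.** *GIN-LGVR* represents $G$ by $\mathrm{ENC}(\mathrm{LGVR}(G,\mathcal C))$, $\mathcal C$ the GIN coloring of $G$. *GIN-LGVR⁺* and *PPGN-LGVR⁺* represent $G$ by $\mathrm{ENC}(\mathrm{LGVR}(G,\mathcal C))+(1+\varepsilon)\sum_{u\in V(G)}\mathcal C(u)$, with $\varepsilon\in\mathbb R$ learnable and $\mathcal C$ the GIN coloring, respectively the node coloring extracted from PPGN. Numbers of layers, widths and dimensions are free and are part of the weights. A model is *at least as powerful* as a test on a class of graphs if there are weights, the same for the whole class, such that any two graphs of the class that the test distinguishes have different representations. It is *strictly more powerful* if the weights can be chosen such that, in addition, some two graphs of the class that the test does not distinguish have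 different representations. **Statement.** 1. For every $c\in\chi$, GIN-LGVR is strictly more powerful than the WL test on the class of those graphs in $\mathcal G$ all of whose node features equal $c$. Also, GIN-LGVR is strictly more powerful than the WL test on the class of those graphs in $\mathcal G$ that have no isolated nodes. 2. GIN-LGVR⁺ is strictly more powerful than the WL test on $\mathcal G$. 3. PPGN-LGVR⁺ is at least as powerful as $3$-WL on $\mathcal G$. -/

import Mathlib

/-! ### Graphs with node features, colour refinement and its higher-order version -/

/-- A finite graph with node features in `ℝ^N`, on the node set `{0, …, order - 1}`
(every finite graph is isomorphic to one of these). -/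
structure FGraph (N : ℕ) where
  order : ℕ
  graph : SimpleGraph (Fin order)
  feat : Fin order → (Fin N → ℝ)

/-- Colours after `t` rounds of colour refinement. The hash of a round is the identity, hence
injective and the same for all graphs: the new colour is the pair of the old colour and the
multiset of the colours of the neighbours. -/
def WLColor (X : Type) : ℕ → Type
  | 0 => X
  | t + 1 => WLColor X t × Multiset (WLColor X t)

open Classical in
noncomputable def wlColor {V X : Type} [Fintype V] (G : SimpleGraph V) (x : V → X) :
    (t : ℕ) → V → WLColor X t
  | 0 => x
  | t + 1 => fun v =>
      (wlColor G x t v, (Finset.univ.filter (fun u => G.Adj v u)).val.map (wlColor G x t))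

/-- The WL test, with the node features as initial colours, distinguishes `G` and `H`: after some
number of rounds the histograms (multisets) of colours differ. -/
def WLDistinguishes {N : ℕ} (G H : FGraph N) : Prop :=
  ∃ t : ℕ, (Finset.univ : Finset (Fin G.order)).val.map (wlColor G.graph G.feat t) ≠
    (Finset.univ : Finset (Fin H.order)).val.map (wlColor H.graph H.feat t)

/-- Colours of `k`-tuples after `t` rounds of `k`-WL. The initial colour is the isomorphism type of
the tuple: features, equality pattern and adjacency pattern. The new colour consists of the old
colour and, for every position `j`, of a multiset of old colours. -/
def KWLColor (k : ℕ) (X : Type) : ℕ → Type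
  | 0 => (Fin k → X) × (Fin k → Fin k → Prop) × (Fin k → Fin k → Prop)
  | t + 1 => KWLColor k X t × (Fin k → Multiset (KWLColor k X t))

/-- In a round, the multiset for position `j` collects the colours of all tuples which arise by
replacing the `j`-th entry by an arbitrary node. -/
noncomputable def kwlColor {V X : Type} [Fintype V] (k : ℕ) (G : SimpleGraph V) (x : V → X) :
    (t : ℕ) → (Fin k → V) → KWLColor k X t
  | 0 => fun p => (fun i => x (p i), fun i j => p i = p j, fun i j => G.Adj (p i) (p j))
  | t + 1 => fun p => (kwlColor k G x t p, fun j =>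
      (Finset.univ : Finset V).val.map (fun u => kwlColor k G x t (Function.update p j u)))

def KWLDistinguishes {N : ℕ} (k : ℕ) (G H : FGraph N) : Prop :=
  ∃ t : ℕ,
    (Finset.univ : Finset (Fin k → Fin G.order)).val.map (kwlColor k G.graph G.feat t) ≠
    (Finset.univ : Finset (Fin k → Fin H.order)).val.map (kwlColor k H.graph H.feat t)

/-! ### Multi-layer perceptrons, GIN and PPGN -/

/-- Activation functions: real-analytic sigmoidal functions (two distinct finite limits at `±∞`),
such as the logistic function or `tanh`. -/
def IsAnalyticSigmoidal (σ : ℝ → ℝ) : Prop :=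
  AnalyticOnNhd ℝ σ Set.univ ∧
    ∃ a b : ℝ, a ≠ b ∧ Filter.Tendsto σ Filter.atBot (nhds a) ∧
      Filter.Tendsto σ Filter.atTop (nhds b)

/-- Weights of a multi-layer perceptron `ℝ^m → ℝ^n` with at least one hidden layer. -/
inductive MLP : ℕ → ℕ → Type
  | shallow {m h n : ℕ} (A : Matrix (Fin h) (Fin m) ℝ) (a : Fin h → ℝ)
      (B : Matrix (Fin n) (Fin h) ℝ) (b : Fin n → ℝ) : MLP m n
  | deep {m h n : ℕ} (A : Matrix (Fin h) (Fin m) ℝ) (a : Fin h → ℝ) (rest : MLP h n) : MLP m n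

/-- The activation `σ` is applied entrywise in the hidden layers; the output layer is affine. -/
noncomputable def MLP.eval (σ : ℝ → ℝ) : {m n : ℕ} → MLP m n → (Fin m → ℝ) → (Fin n → ℝ)
  | _, _, .shallow A a B b => fun x => B.mulVec (fun i => σ (A.mulVec x i + a i)) + b
  | _, _, .deep A a rest => fun x => rest.eval σ (fun i => σ (A.mulVec x i + a i))

/-- Weights of at least one GIN layer. -/
inductive GINLayers : ℕ → ℕ → Type
  | one {a b : ℕ} (ε : ℝ) (m : MLP a b) : GINLayers a b
  | cons {a b c : ℕ} (ε : ℝ) (m : MLP a b) (rest : GINLayers b c) : GINLayers a c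

/-- One GIN aggregation `v ↦ (1 + ε) x_v + ∑_{u ∈ N(v)} x_u`. -/
noncomputable def ginAggregate {V : Type} [Fintype V] (G : SimpleGraph V) {a : ℕ} (ε : ℝ)
    (x : V → (Fin a → ℝ)) (v : V) : Fin a → ℝ :=
  open Classical in (1 + ε) • x v + ∑ u ∈ Finset.univ.filter (fun u => G.Adj v u), x u

noncomputable def GINLayers.eval (σ : ℝ → ℝ) {V : Type} [Fintype V] (G : SimpleGraph V) :
    {a b : ℕ} → GINLayers a b → (V → (Fin a → ℝ)) → (V → (Fin b → ℝ))
  | _, _, .one ε m => fun x v => m.eval σ (ginAggregate G ε x v)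
  | _, _, .cons ε m rest => fun x => rest.eval σ G (fun v => m.eval σ (ginAggregate G ε x v))

/-- Weights of a GIN `ℝ^a → ℝ^b` at node level. The input features, which need not be one-hot
vectors, are passed through a perceptron before the first aggregation. -/
structure GIN (a b : ℕ) where
  width : ℕ
  init : MLP a width
  layers : GINLayers width b

noncomputable def GIN.eval (σ : ℝ → ℝ) {V : Type} [Fintype V] (G : SimpleGraph V) {a b : ℕ}
    (g : GIN a b) (x : V → (Fin a → ℝ)) : V → (Fin b → ℝ) :=
  g.layers.eval σ G (fun v => g.init.eval σ (x v))

/-- Weights of a PPGN block with `a` input channels, `b` matrix-product channels and `b'`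
channels of the direct path. -/
structure PPGNBlock (a b b' : ℕ) where
  m₁ : MLP a b
  m₂ : MLP a b
  m₃ : MLP a b'

/-- The block sends a tensor `Y` to the concatenation of `m₃(Y)` and the channelwise matrix
product of `m₁(Y)` and `m₂(Y)`, the perceptrons acting on the channels of each node pair. -/
noncomputable def PPGNBlock.eval (σ : ℝ → ℝ) {V : Type} [Fintype V] {a b b' : ℕ}
    (B : PPGNBlock a b b') (Y : V → V → (Fin a → ℝ)) (u v : V) : Fin (b' + b) → ℝ :=
  Fin.append (B.m₃.eval σ (Y u v))
    (fun c => ∑ w : V, B.m₁.eval σ (Y u w) c * B.m₂.eval σ (Y w v) c)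

/-- Weights of at least one PPGN block. -/
inductive PPGN : ℕ → ℕ → Type
  | one {a b b' : ℕ} (B : PPGNBlock a b b') : PPGN a (b' + b)
  | cons {a b b' c : ℕ} (B : PPGNBlock a b b') (rest : PPGN (b' + b) c) : PPGN a c

noncomputable def PPGN.eval (σ : ℝ → ℝ) {V : Type} [Fintype V] :
    {a b : ℕ} → PPGN a b → (V → V → (Fin a → ℝ)) → (V → V → (Fin b → ℝ))
  | _, _, .one B => fun Y => B.eval σ Y
  | _, _, .cons B rest => fun Y => rest.eval σ (B.eval σ Y)

/-- The input tensor of PPGN: node features on the diagonal, adjacency matrix, identity matrix. -/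
noncomputable def ppgnInput {N : ℕ} {V : Type} (G : SimpleGraph V) (x : V → (Fin N → ℝ))
    (u v : V) : Fin (N + 2) → ℝ :=
  open Classical in
  Fin.append (if u = v then x u else 0) ![if G.Adj u v then 1 else 0, if u = v then 1 else 0]

/-! ### Persistence diagrams of skeleta of Vietoris-Rips filtrations -/

/-- The Vietoris-Rips complex of `(V, M)` whose simplices are the nonempty sets of points with all
pairwise values of `M` in `I`. The scale-`ε` complex is the case `I = (-∞, ε]`; the case
`I = (-∞, ε)` is the union of the complexes of all scales smaller than `ε`. -/
def vrComplex {V : Type} (M : V → V → ℝ) (I : Set ℝ) : PreAbstractSimplicialComplex V where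
  faces := {s | s.Nonempty ∧ ∀ u ∈ s, ∀ v ∈ s, M u v ∈ I}
  isRelLowerSet_faces := fun _ hs =>
    ⟨hs.1, fun _ hts ht => ⟨ht, fun u hu v hv => hs.2 u (hts hu) v (hts hv)⟩⟩

/-- The `k`-skeleton. -/
def skeleton {V : Type} (k : ℕ) (K : PreAbstractSimplicialComplex V) :
    PreAbstractSimplicialComplex V where
  faces := {s | s ∈ K.faces ∧ s.card ≤ k + 1}
  isRelLowerSet_faces := fun _ hs =>
    ⟨(K.isRelLowerSet_faces hs.1).1, fun _ hts ht =>
      ⟨(K.isRelLowerSet_faces hs.1).2 hts ht, (Finset.card_le_card hts).trans hs.2⟩⟩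

/-- Simplicial `n`-chains, inside the space spanned by all finite sets of points. The coefficient
field `F` is a parameter here; it has characteristic two (so that simplices need no orientation),
and is `ℤ/2` below. -/
noncomputable def simplicialChains (F : Type) [Field F] {V : Type} (n : ℕ)
    (K : PreAbstractSimplicialComplex V) : Submodule F (Finset V →₀ F) :=
  Finsupp.supported F F {s | s ∈ K.faces ∧ s.card = n + 1}

/-- The boundary of a simplex is the sum of its facets. -/
noncomputable def simplicialBoundary (F : Type) [Field F] (V : Type) :
    (Finset V →₀ F) →ₗ[F] (Finset V →₀ F) :=
  open Classical in
  Finsupp.linearCombination F (fun s => ∑ v ∈ s, Finsupp.single (s.erase v) (1 : F))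

/-- `n`-cycles; every `0`-chain is a cycle (homology is not reduced). -/
noncomputable def simplicialCycles (F : Type) [Field F] {V : Type} (n : ℕ)
    (K : PreAbstractSimplicialComplex V) : Submodule F (Finset V →₀ F) :=
  if n = 0 then simplicialChains F 0 K
  else simplicialChains F n K ⊓ LinearMap.ker (simplicialBoundary F V)

noncomputable def simplicialBoundaries (F : Type) [Field F] {V : Type} (n : ℕ)
    (K : PreAbstractSimplicialComplex V) : Submodule F (Finset V →₀ F) :=
  (simplicialChains F (n + 1) K).map (simplicialBoundary F V)

/-- For `K ≤ L`, the rank of `H_n(K) → H_n(L)`: the dimension of the image of the cycles of `K` in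
the quotient by the boundaries of `L`, which contains `H_n(L)`. -/
noncomputable def persistentBetti (F : Type) [Field F] {V : Type} (n : ℕ)
    (K L : PreAbstractSimplicialComplex V) : ℕ :=
  Module.finrank F ((simplicialCycles F n K).map (simplicialBoundaries F n L).mkQ)

/-- `persistentBetti` over `ℤ/2` for the `1`-skeleta of the Vietoris-Rips complexes given by `I ⊆ J`. -/
noncomputable def vrBetti {V : Type} (n : ℕ) (M : V → V → ℝ) (I J : Set ℝ) : ℤ :=
  persistentBetti (ZMod 2) n (skeleton 1 (vrComplex M I)) (skeleton 1 (vrComplex M J))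

/-- Number of `n`-th homology classes which are born exactly at `b` and die exactly at `d`, where
`b < d`. -/
noncomputable def diagramMultiplicity {V : Type} (n : ℕ) (M : V → V → ℝ) (b d : ℝ) : ℕ :=
  ((vrBetti n M (Set.Iic b) (Set.Iio d) - vrBetti n M (Set.Iio b) (Set.Iio d)) -
    (vrBetti n M (Set.Iic b) (Set.Iic d) - vrBetti n M (Set.Iio b) (Set.Iic d))).toNat

/-- Number of `n`-th homology classes which are born exactly at `b ≤ r` and are still alive at the
largest scale `r` of the filtration. -/
noncomputable def essentialMultiplicity {V : Type} (n : ℕ) (M : V → V → ℝ) (r b : ℝ) : ℕ :=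
  (vrBetti n M (Set.Iic b) (Set.Iic r) - vrBetti n M (Set.Iio b) (Set.Iic r)).toNat

/-- The scales up to `r` at which the Vietoris-Rips complex can change. -/
noncomputable def criticalScales {V : Type} [Fintype V] (M : V → V → ℝ) (r : ℝ) : Finset ℝ :=
  open Classical in
  ((Finset.univ : Finset (V × V)).image (fun p => M p.1 p.2)).filter (fun t => t ≤ r)

/-- The `n`-th persistence diagram of the `1`-skeleta of the Vietoris-Rips filtration of `(V, M)`
with scales up to `r`, for symmetric `M ≥ 0` with zero diagonal: a multiset of pairs
(birth, death), where the death is `⊤` for the classes which do not die. -/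
noncomputable def persistenceDiagram {V : Type} [Fintype V] (n : ℕ) (M : V → V → ℝ) (r : ℝ) :
    Multiset (ℝ × WithTop ℝ) :=
  (∑ b ∈ criticalScales M r, ∑ d ∈ (criticalScales M r).filter (fun d => b < d),
      Multiset.replicate (diagramMultiplicity n M b d) (b, (d : WithTop ℝ))) +
    ∑ b ∈ criticalScales M r, Multiset.replicate (essentialMultiplicity n M r b) (b, ⊤)

/-! ### The line graph Vietoris-Rips persistence diagram -/

/-- The map `{{x, y}} ↦ (g(x) + g(y), |g(x) - g(y)|)` with `g(z) = z + η m(z)`. -/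
noncomputable def phiMap (σ : ℝ → ℝ) {d : ℕ} (m : MLP d d) (η : ℝ) :
    Sym2 (Fin d → ℝ) → (Fin (d + d) → ℝ) :=
  Sym2.lift ⟨fun x y =>
      Fin.append ((x + η • m.eval σ x) + (y + η • m.eval σ y))
        (fun i => |(x + η • m.eval σ x) i - (y + η • m.eval σ y) i|),
    fun x y => by
      simp only [add_comm (x + η • m.eval σ x) (y + η • m.eval σ y), abs_sub_comm]⟩

/-- Weights of LGVR for node colourings with values in `ℝ^d`. -/
structure LGVRWeights (d : ℕ) where
  m : MLP d d
  η : ℝ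
  width : ℕ
  P₁ : GIN (d + d) width
  P₂ : GIN width 1

/-- The coloured line graph of `(G, c)`, refined by the GIN `P₁`. -/
noncomputable def LGVRWeights.lineColor (σ : ℝ → ℝ) {d : ℕ} (θ : LGVRWeights d) {V : Type}
    [Fintype V] (G : SimpleGraph V) (c : V → (Fin d → ℝ)) : G.edgeSet → (Fin θ.width → ℝ) :=
  open Classical in
  θ.P₁.eval σ G.lineGraph (fun e => phiMap σ θ.m θ.η (Sym2.map c e.1))

/-- The colours of the nodes of the line graph of the complete graph on `V`: the colouring
`lineColor`, extended by `0` to virtual edges, is passed through the GIN `P₂`, whose output is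
made `[0,1]`-valued by the logistic function. -/
noncomputable def LGVRWeights.edgeValue (σ : ℝ → ℝ) {d : ℕ} (θ : LGVRWeights d) {V : Type}
    [Fintype V] (G : SimpleGraph V) (c : V → (Fin d → ℝ)) :
    (⊤ : SimpleGraph V).edgeSet → ℝ :=
  open Classical in
  fun e => Real.sigmoid (θ.P₂.eval σ (⊤ : SimpleGraph V).lineGraph
    (fun f => if h : f.1 ∈ G.edgeSet then θ.lineColor σ G c ⟨f.1, h⟩ else 0) e 0)

/-- The edge filtration matrix. -/
noncomputable def LGVRWeights.filtrationMatrix (σ : ℝ → ℝ) {d : ℕ} (θ : LGVRWeights d) {V : Type}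
    [Fintype V] (G : SimpleGraph V) (c : V → (Fin d → ℝ)) (u v : V) : ℝ :=
  open Classical in
  if h : u = v then 0 else θ.edgeValue σ G c ⟨s(u, v), h⟩

/-- The LGVR diagram: the `0`-th and `1`-st persistence diagrams over the scales `[0, 1/2]`. -/
noncomputable def LGVRWeights.diagram (σ : ℝ → ℝ) {d : ℕ} (θ : LGVRWeights d) {V : Type}
    [Fintype V] (G : SimpleGraph V) (c : V → (Fin d → ℝ)) :
    Multiset (ℝ × WithTop ℝ) × Multiset (ℝ × WithTop ℝ) :=
  (persistenceDiagram 0 (θ.filtrationMatrix σ G c) (1 / 2),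
    persistenceDiagram 1 (θ.filtrationMatrix σ G c) (1 / 2))

/-- A point of a diagram as a vector in `ℝ²`. The death `⊤` is entered as `1`, the upper end of the
range of the edge values; finite deaths are at most `1/2`. -/
noncomputable def diagramPoint (p : ℝ × WithTop ℝ) : Fin 2 → ℝ := ![p.1, p.2.untopD 1]

/-- Weights of a set encoder with values in `ℝ^n` for pairs of persistence diagrams. -/
structure SetEncoder (n : ℕ) where
  w₀ : ℕ
  w₁ : ℕ
  S₀ : MLP 2 w₀
  S₁ : MLP 2 w₁
  m : MLP (w₀ + w₁) n

/-- `(D₀, D₁) ↦ m (∑_{p ∈ D₀} S₀(p), ∑_{p ∈ D₁} S₁(p))`. -/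
noncomputable def SetEncoder.eval (σ : ℝ → ℝ) {n : ℕ} (S : SetEncoder n)
    (D : Multiset (ℝ × WithTop ℝ) × Multiset (ℝ × WithTop ℝ)) : Fin n → ℝ :=
  S.m.eval σ (Fin.append ((D.1.map (fun p => S.S₀.eval σ (diagramPoint p))).sum)
    ((D.2.map (fun p => S.S₁.eval σ (diagramPoint p))).sum))

/-! ### The three models -/

/-- Weights of GIN-LGVR for features in `ℝ^N`; `d` is the dimension of the node colours and `out`
that of the graph representation. -/
structure GINLGVR (N : ℕ) where
  d : ℕ
  out : ℕ
  gin : GIN N d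
  lgvr : LGVRWeights d
  enc : SetEncoder out

/-- The GIN-LGVR representation of a graph: the encoded LGVR diagram of the GIN colouring. -/
noncomputable def GINLGVR.rep (σ : ℝ → ℝ) {N : ℕ} (θ : GINLGVR N) (G : FGraph N) :
    Fin θ.out → ℝ :=
  θ.enc.eval σ (θ.lgvr.diagram σ G.graph (θ.gin.eval σ G.graph G.feat))

/-- Weights of GIN-LGVR⁺. -/
structure GINLGVRPlus (N : ℕ) where
  d : ℕ
  gin : GIN N d
  lgvr : LGVRWeights d
  enc : SetEncoder d
  ε : ℝ

/-- The GIN-LGVR⁺ representation: the GIN-LGVR representation plus `(1 + ε)` times the sum of the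
GIN colours of all nodes. -/
noncomputable def GINLGVRPlus.rep (σ : ℝ → ℝ) {N : ℕ} (θ : GINLGVRPlus N) (G : FGraph N) :
    Fin θ.d → ℝ :=
  θ.enc.eval σ (θ.lgvr.diagram σ G.graph (θ.gin.eval σ G.graph G.feat)) +
    (1 + θ.ε) • ∑ u, θ.gin.eval σ G.graph G.feat u

/-- Weights of PPGN-LGVR⁺. -/
structure PPGNLGVRPlus (N : ℕ) where
  d : ℕ
  ppgn : PPGN (N + 2) d
  lgvr : LGVRWeights d
  enc : SetEncoder d
  ε : ℝ

/-- The node colouring extracted from PPGN: the diagonal of its output tensor. -/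
noncomputable def PPGNLGVRPlus.nodeColor (σ : ℝ → ℝ) {N : ℕ} (θ : PPGNLGVRPlus N)
    (G : FGraph N) (u : Fin G.order) : Fin θ.d → ℝ :=
  θ.ppgn.eval σ (ppgnInput G.graph G.feat) u u

/-- The PPGN-LGVR⁺ representation: the encoded LGVR diagram of the node colouring plus `(1 + ε)`
times the sum of the colours of all nodes. -/
noncomputable def PPGNLGVRPlus.rep (σ : ℝ → ℝ) {N : ℕ} (θ : PPGNLGVRPlus N) (G : FGraph N) :
    Fin θ.d → ℝ :=
  θ.enc.eval σ (θ.lgvr.diagram σ G.graph (θ.nodeColor σ G)) +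
    (1 + θ.ε) • ∑ u, θ.nodeColor σ G u

/-! ### Comparing a family of models with a test -/

/-- With suitable weights, the same for all graphs of the class `𝒢`, the model distinguishes all
pairs which the test distinguishes. -/
def AtLeastAsPowerful {N : ℕ} {Θ : Type} {out : Θ → ℕ}
    (rep : (θ : Θ) → FGraph N → (Fin (out θ) → ℝ)) (test : FGraph N → FGraph N → Prop)
    (𝒢 : Set (FGraph N)) : Prop :=
  ∃ θ : Θ, ∀ G ∈ 𝒢, ∀ H ∈ 𝒢, test G H → rep θ G ≠ rep θ H

/-- With suitable weights, the same for all graphs of the class `𝒢`, the model distinguishes all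
pairs which the test distinguishes, and also some pair which the test does not distinguish. -/
def StrictlyMorePowerful {N : ℕ} {Θ : Type} {out : Θ → ℕ}
    (rep : (θ : Θ) → FGraph N → (Fin (out θ) → ℝ)) (test : FGraph N → FGraph N → Prop)
    (𝒢 : Set (FGraph N)) : Prop :=
  ∃ θ : Θ, (∀ G ∈ 𝒢, ∀ H ∈ 𝒢, test G H → rep θ G ≠ rep θ H) ∧
    ∃ G ∈ 𝒢, ∃ H ∈ 𝒢, ¬ test G H ∧ rep θ G ≠ rep θ H

/-- The graphs with at most `n` nodes and with node features in `χ`. -/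
def boundedGraphs {N : ℕ} (χ : Set (Fin N → ℝ)) (n : ℕ) : Set (FGraph N) :=
  {G | G.order ≤ n ∧ ∀ v, G.feat v ∈ χ}

/-- No node is isolated. -/
def FGraph.NoIsolated {N : ℕ} (G : FGraph N) : Prop := ∀ v, ∃ u, G.graph.Adj v u

/-!
A unit `x ↦ σ (w ⬝ᵥ x + s)` depends analytically on its weights, so for generic weights none of
countably many nonzero formal combinations of points is sent to `0`. Hence there are perceptrons
for which the sum of the values over a finite multiset of points of a countable set determines the
multiset. With such perceptrons a layer of GIN carries out a round of WL, and a block of PPGN a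
round of the folklore refinement of pairs, which refines as much as `3`-WL. On graphs with at most
`n` nodes these refinements become stationary after a number of rounds that depends on `n` only.

In LGVR the weights can be chosen such that exactly the edges of the graph have a value of at most
`1 / 2`, and such that the value of an edge determines the colours of its endpoints. In a filtration
by `1`-skeleta an edge either merges two components or creates a cycle that never dies, so the two
diagrams together determine the multiset of the values of the edges. Since a WL colour determines
the degree of its node, this gives the multiset of the colours of the nodes that are not isolated.
The number of the remaining nodes follows from the number of points of the first diagram, which is
the number of all nodes; for their colours, the sum of the colouring over all nodes is needed.

The number of components, which is the number of points of the first diagram that never die,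
separates the cycle of length six from two triangles, whereas WL does not.
-/

open Filter Topology

/-! ### Generic units of an analytic sigmoidal activation -/

theorem countable_zeros_of_analyticOnNhd {f : ℝ → ℝ} (hf : AnalyticOnNhd ℝ f Set.univ) {y : ℝ}
    (hy : f y ≠ 0) : {x | f x = 0}.Countable := by
  have hd : IsDiscrete {x | f x = 0} := by
    simpa [Set.compl_def] using (mem_codiscrete'.1 (hf.preimage_zero_mem_codiscrete hy)).2
  have := hd.to_subtype
  exact Set.countable_coe_iff.1 (TopologicalSpace.separableSpace_iff_countable.1 inferInstance)

theorem analyticOnNhd_linearCombination {α : Type*} {f : α → ℝ → ℝ}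
    (hf : ∀ x, AnalyticOnNhd ℝ (f x) Set.univ) (c : α →₀ ℝ) :
    AnalyticOnNhd ℝ (fun r => Finsupp.linearCombination ℝ (fun x => f x r) c) Set.univ := by
  simp only [Finsupp.linearCombination_apply, Finsupp.sum, smul_eq_mul]
  exact Finset.analyticOnNhd_fun_sum _ fun x _ => analyticOnNhd_const.mul (hf x)

theorem exists_forall_ne_zero {ι : Type*} {f : ι → ℝ → ℝ} {I : Set ι} (hI : I.Countable)
    (hf : ∀ i, AnalyticOnNhd ℝ (f i) Set.univ) (h0 : ∀ i ∈ I, ∃ x, f i x ≠ 0) :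
    ∃ x, ∀ i ∈ I, f i x ≠ 0 := by
  choose! y hy using h0
  obtain ⟨x, hx⟩ := ((hI.biUnion fun i hi =>
    countable_zeros_of_analyticOnNhd (hf i) (hy i hi)).dense_compl ℝ).nonempty
  exact ⟨x, fun i hi h => hx (Set.mem_biUnion hi h)⟩

theorem exists_smul_add_injOn {E : Type*} [AddCommGroup E] [Module ℝ E] {S : Set (E × E)}
    (hS : S.Countable) {l r : ℝ} (hlr : l < r) :
    ∃ t, l < t ∧ t < r ∧ Set.InjOn (fun p : E × E => t • p.1 + p.2) S := by
  have hbad : (⋃ q ∈ S ×ˢ S, {t : ℝ | q.1 ≠ q.2 ∧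
      t • q.1.1 + q.1.2 = t • q.2.1 + q.2.2}).Countable := by
    refine (hS.prod hS).biUnion fun q _ => Set.Subsingleton.countable ?_
    rintro t ⟨hne, ht⟩ t' ⟨-, ht'⟩
    have h : (t - t') • (q.1.1 - q.2.1) = 0 := by
      calc (t - t') • (q.1.1 - q.2.1)
          = (t • q.1.1 + q.1.2 - (t • q.2.1 + q.2.2))
            - (t' • q.1.1 + q.1.2 - (t' • q.2.1 + q.2.2)) := by module
        _ = 0 := by rw [ht, ht']; simp
    rcases smul_eq_zero.1 h with h | h
    · exact sub_eq_zero.1 h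
    · have h1 := sub_eq_zero.1 h
      rw [h1] at ht
      exact absurd (Prod.ext h1 (add_left_cancel ht)) hne
  obtain ⟨t, ht, hl, hr⟩ := (hbad.dense_compl ℝ).exists_between hlr
  refine ⟨t, hl, hr, fun p hp q hq h => ?_⟩
  by_contra hne
  exact ht (Set.mem_biUnion (Set.mk_mem_prod hp hq) ⟨hne, h⟩)

theorem exists_forall_dotProduct_ne_zero {ι : Type*} [Fintype ι] {S : Set (ι → ℝ)}
    (hS : S.Countable) (h0 : ∀ z ∈ S, z ≠ 0) : ∃ w : ι → ℝ, ∀ z ∈ S, w ⬝ᵥ z ≠ 0 := by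
  have hnull : ∀ z ∈ S, ∀ᵐ w : ι → ℝ, w ⬝ᵥ z ≠ 0 := by
    intro z hz
    let φ : (ι → ℝ) →ₗ[ℝ] ℝ := (dotProductBilin ℝ ℝ).flip z
    have hφ : LinearMap.ker φ ≠ ⊤ := fun h =>
      h0 z hz (dotProduct_self_eq_zero.1 (LinearMap.congr_fun (LinearMap.ker_eq_top.1 h) z))
    have hker : {w : ι → ℝ | ¬ w ⬝ᵥ z ≠ 0} = LinearMap.ker φ := by
      ext w; simp [φ, dotProductBilin]
    rw [MeasureTheory.ae_iff, hker]
    exact MeasureTheory.Measure.addHaar_submodule MeasureTheory.volume _ hφ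
  exact ((MeasureTheory.ae_ball_iff hS).2 hnull).exists

theorem exists_dotProduct_injOn {ι : Type*} [Fintype ι] {S : Set (ι → ℝ)} (hS : S.Countable) :
    ∃ w : ι → ℝ, Set.InjOn (fun x => w ⬝ᵥ x) S := by
  obtain ⟨w, hw⟩ := exists_forall_dotProduct_ne_zero
    (((hS.prod hS).image fun p => p.1 - p.2).mono (Set.sdiff_subset (t := {0}))) (fun _ h => h.2)
  refine ⟨w, fun x hx y hy hxy => ?_⟩
  by_contra hne
  refine hw (x - y) ⟨⟨(x, y), ⟨hx, hy⟩, rfl⟩, sub_ne_zero.2 hne⟩ ?_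
  rw [dotProduct_sub]
  exact sub_eq_zero.2 hxy

theorem tendsto_unit_of_lt {σ : ℝ → ℝ} {a : ℝ} (ha : Tendsto σ atBot (𝓝 a)) {x x₀ : ℝ}
    (hx : x < x₀) (s : ℝ) : Tendsto (fun t => σ (t * x + (s - t * x₀))) atTop (𝓝 a) := by
  have h : (fun t : ℝ => t * x + (s - t * x₀)) = fun t => t * (x - x₀) + s := by
    ext t; ring
  refine ha.comp (h ▸ ?_)
  exact tendsto_atBot_add_const_right _ _ (tendsto_id.atTop_mul_const_of_neg (sub_neg.2 hx))

/-- Translating the argument so that the largest point of the support stays put, all other units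
tend to their limit at `-∞` as the slope grows, whereas the value at that point is arbitrary. -/
theorem exists_linearCombination_units_ne_zero {σ : ℝ → ℝ} {a : ℝ} (ha : Tendsto σ atBot (𝓝 a))
    {y y' : ℝ} (hy : σ y ≠ σ y') {c : ℝ →₀ ℝ} (hc : c ≠ 0) :
    ∃ t s, Finsupp.linearCombination ℝ (fun x => σ (t * x + s)) c ≠ 0 := by
  by_contra! h
  have hne : c.support.Nonempty := Finsupp.support_nonempty_iff.2 hc
  set x₀ := c.support.max' hne
  have hx₀ : x₀ ∈ c.support := c.support.max'_mem hne
  have hlim : ∀ s, c x₀ * σ s + ∑ x ∈ c.support.erase x₀, c x * a = 0 := by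
    intro s
    have hsum : Tendsto (fun t : ℝ => c x₀ * σ s +
        ∑ x ∈ c.support.erase x₀, c x * σ (t * x + (s - t * x₀))) atTop
        (𝓝 (c x₀ * σ s + ∑ x ∈ c.support.erase x₀, c x * a)) :=
      (tendsto_finsetSum _ fun x hx => (tendsto_unit_of_lt ha
        (c.support.lt_max'_of_mem_erase_max' hne hx) s).const_mul _).const_add _
    refine tendsto_nhds_unique hsum (tendsto_const_nhds.congr fun t => ?_)
    rw [← h t (s - t * x₀), Finsupp.linearCombination_apply, Finsupp.sum,
      ← Finset.add_sum_erase _ _ hx₀]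
    simp only [smul_eq_mul, add_sub_cancel]
  exact hy (mul_left_cancel₀ (Finsupp.mem_support_iff.1 hx₀)
    (add_right_cancel ((hlim y).trans (hlim y').symm)))

namespace IsAnalyticSigmoidal

variable {σ : ℝ → ℝ} (hσ : IsAnalyticSigmoidal σ)
include hσ

theorem continuous : Continuous σ :=
  continuousOn_univ.1 hσ.1.continuousOn

theorem exists_ne : ∃ x y, σ x ≠ σ y := by
  by_contra! h
  obtain ⟨a, b, hab, ha, hb⟩ := hσ.2
  have hc : σ = fun _ => σ 0 := funext fun x => h x 0
  rw [hc, tendsto_const_nhds_iff] at ha hb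
  exact hab (ha.symm.trans hb)

theorem exists_forall_abs_le : ∃ K > 0, ∀ x, |σ x| ≤ K := by
  obtain ⟨a, b, -, ha, hb⟩ := hσ.2
  obtain ⟨A, hA⟩ := eventually_atBot.1 (ha.abs.eventually_lt_const (lt_add_one |a|))
  obtain ⟨B, hB⟩ := eventually_atTop.1 (hb.abs.eventually_lt_const (lt_add_one |b|))
  obtain ⟨K, hK⟩ := (isCompact_Icc (a := A) (b := B)).exists_bound_of_continuousOn
    hσ.continuous.continuousOn
  refine ⟨max (max (|a| + 1) (|b| + 1)) K, by positivity, fun x => ?_⟩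
  rcases le_total x A with h | h
  · exact (hA x h).le.trans (by simp)
  rcases le_total B x with h' | h'
  · exact (hB x h').le.trans (by simp)
  · exact (hK x ⟨h, h'⟩).trans (le_max_right _ _)

theorem exists_unit_real_ne_zero {C : Set (ℝ →₀ ℝ)} (hC : C.Countable) (h0 : ∀ c ∈ C, c ≠ 0) :
    ∃ t s, ∀ c ∈ C, Finsupp.linearCombination ℝ (fun x => σ (t * x + s)) c ≠ 0 := by
  obtain ⟨a, -, -, ha, -⟩ := hσ.2
  obtain ⟨y, y', hy⟩ := hσ.exists_ne
  have hcomp {p : ℝ → ℝ} (hp : AnalyticOnNhd ℝ p Set.univ) :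
      AnalyticOnNhd ℝ (fun r => σ (p r)) Set.univ := hσ.1.comp hp fun _ _ => Set.mem_univ _
  choose! T S hTS using fun c hc => exists_linearCombination_units_ne_zero ha hy (h0 c hc)
  obtain ⟨t, ht⟩ := exists_forall_ne_zero hC
    (fun c => analyticOnNhd_linearCombination (f := fun x t => σ (t * x + S c)) (fun x =>
      hcomp ((analyticOnNhd_id.mul analyticOnNhd_const).add analyticOnNhd_const)) c)
    (fun c hc => ⟨T c, hTS c hc⟩)
  obtain ⟨s, hs⟩ := exists_forall_ne_zero hC
    (fun c => analyticOnNhd_linearCombination (f := fun x s => σ (t * x + s)) (fun x =>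
      hcomp (analyticOnNhd_const.add analyticOnNhd_id)) c)
    (fun c hc => ⟨S c, ht c hc⟩)
  exact ⟨t, s, hs⟩

theorem exists_unit_injOn {ι : Type*} [Fintype ι] {C : Set ((ι → ℝ) →₀ ℝ)} (hC : C.Countable) :
    ∃ (w : ι → ℝ) (s : ℝ),
      Set.InjOn (Finsupp.linearCombination ℝ fun x => σ (w ⬝ᵥ x + s)) C := by
  obtain ⟨w, hw⟩ := exists_dotProduct_injOn (hC.biUnion fun c _ => c.support.countable_toSet)
  have hmap := (Finsupp.mapDomain_injOn (M := ℝ) _ hw).mono fun c hc =>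
    Set.subset_biUnion_of_mem (u := fun c => (c.support : Set (ι → ℝ))) hc
  set D := Finsupp.mapDomain (M := ℝ) (fun x => w ⬝ᵥ x)
  obtain ⟨t, s, hts⟩ := hσ.exists_unit_real_ne_zero
    (((hC.prod hC).image fun p => D p.1 - D p.2).mono (Set.sdiff_subset (t := {0})))
    (fun _ h => h.2)
  refine ⟨t • w, s, fun c hc c' hc' h => ?_⟩
  by_contra hne
  refine hts (D c - D c') ⟨⟨(c, c'), ⟨hc, hc'⟩, rfl⟩, sub_ne_zero.2 (hmap.ne hc hc' hne)⟩ ?_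
  rw [map_sub, sub_eq_zero, Finsupp.linearCombination_mapDomain,
    Finsupp.linearCombination_mapDomain]
  simpa only [Function.comp_def, smul_dotProduct, smul_eq_mul] using h

end IsAnalyticSigmoidal

/-- The functions computed by a single hidden unit with a scalar affine output. -/
def IsSingleUnit (σ : ℝ → ℝ) {m : ℕ} (f : (Fin m → ℝ) → ℝ) : Prop :=
  ∃ (β : ℝ) (w : Fin m → ℝ) (s b : ℝ), ∀ x, f x = β * σ (w ⬝ᵥ x + s) + b

theorem isSingleUnit_const (σ : ℝ → ℝ) {m : ℕ} (r : ℝ) :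
    IsSingleUnit σ (fun _ : Fin m → ℝ => r) :=
  ⟨0, 0, 0, r, by simp⟩

/-- The perceptron `x ↦ β σ(w·x + s) + δ σ(w'·x + s') + b` with two hidden units. -/
def MLP.twoUnits {m : ℕ} (β : ℝ) (w : Fin m → ℝ) (s δ : ℝ) (w' : Fin m → ℝ) (s' b : ℝ) : MLP m 1 :=
  .shallow ![w, w'] ![s, s'] ![![β, δ]] ![b]

theorem MLP.twoUnits_eval (σ : ℝ → ℝ) {m : ℕ} (β : ℝ) (w : Fin m → ℝ) (s δ : ℝ)
    (w' : Fin m → ℝ) (s' b : ℝ) (x : Fin m → ℝ) :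
    (MLP.twoUnits β w s δ w' s' b).eval σ x 0 =
      β * σ (w ⬝ᵥ x + s) + δ * σ (w' ⬝ᵥ x + s') + b := by
  simp [MLP.twoUnits, MLP.eval, Matrix.mulVec, dotProduct, Fin.sum_univ_two]

instance {m n : ℕ} : Inhabited (MLP m n) := ⟨.shallow (h := 0) 0 0 0 0⟩

theorem IsAnalyticSigmoidal.exists_mlp_injOn_near {σ : ℝ → ℝ} (hσ : IsAnalyticSigmoidal σ) {m : ℕ}
    {C : Set ((Fin m → ℝ) →₀ ℝ)} (hC : C.Countable) {f : (Fin m → ℝ) → ℝ} (hf : IsSingleUnit σ f)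
    {η : ℝ} (hη : 0 < η) :
    ∃ g : MLP m 1, (∀ x, |g.eval σ x 0 - f x| < η) ∧
      Set.InjOn (Finsupp.linearCombination ℝ fun x => g.eval σ x 0) C := by
  obtain ⟨β, w, s, b, hf⟩ := hf
  obtain ⟨w', s', hinj⟩ := hσ.exists_unit_injOn hC
  obtain ⟨K, hK, hσK⟩ := hσ.exists_forall_abs_le
  set u : (Fin m → ℝ) → ℝ := fun x => σ (w' ⬝ᵥ x + s')
  obtain ⟨δ, hδ0, hδ1, hδ⟩ := exists_smul_add_injOn
    (hC.image fun c => (Finsupp.linearCombination ℝ u c, Finsupp.linearCombination ℝ f c))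
    (show (0 : ℝ) < η / K by positivity)
  have heval : ∀ x, (MLP.twoUnits β w s δ w' s' b).eval σ x 0 = δ * u x + f x := fun x => by
    rw [MLP.twoUnits_eval, hf]; ring
  refine ⟨.twoUnits β w s δ w' s' b, fun x => ?_, fun c hc c' hc' h => ?_⟩
  · rw [heval, add_sub_cancel_right, abs_mul, abs_of_pos hδ0]
    calc δ * |u x| ≤ δ * K := by gcongr; exact hσK _
      _ < η := (lt_div_iff₀ hK).1 hδ1
  · have hlin : ∀ c, Finsupp.linearCombination ℝ (fun x => δ * u x + f x) c =
        δ • Finsupp.linearCombination ℝ u c + Finsupp.linearCombination ℝ f c := fun c => by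
      simp only [Finsupp.linearCombination_apply, Finsupp.sum, smul_eq_mul, Finset.mul_sum,
        ← Finset.sum_add_distrib]
      exact Finset.sum_congr rfl fun x _ => by ring
    simp only [heval, hlin] at h
    exact hinj hc hc' (congrArg Prod.fst (hδ ⟨c, hc, rfl⟩ ⟨c', hc', rfl⟩ h))

/-! ### Functions whose sums determine finite multisets -/

theorem map_eq_map_of_forall_imp {α β γ δ : Type*} {M : Multiset α} {M' : Multiset β}
    {f : α → γ} {f' : β → γ} {g : α → δ} {g' : β → δ}
    (h : ∀ a ∈ M, ∀ b ∈ M', f a = f' b → g a = g' b) (hM : M.map f = M'.map f') :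
    M.map g = M'.map g' := by
  rw [← Multiset.rel_eq, Multiset.rel_map] at hM ⊢
  exact hM.mono h

/-- Sums of values of `f` over finite multisets of points of `S` determine the multiset. -/
def SumInjOn {α E : Type*} [AddCommMonoid E] (f : α → E) (S : Set α) : Prop :=
  Set.InjOn (fun M : Multiset α => (M.map f).sum) {M | ∀ x ∈ M, x ∈ S}

theorem SumInjOn.injOn {α E : Type*} [AddCommMonoid E] {f : α → E} {S : Set α}
    (h : SumInjOn f S) : Set.InjOn f S := fun x hx y hy hxy =>
  Multiset.singleton_inj.1 (@h {x} (by simpa) {y} (by simpa) (by simpa))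

theorem SumInjOn.comp {α β E : Type*} [AddCommMonoid E] {g : β → E} {f : α → β} {S : Set α}
    (hg : SumInjOn g (f '' S)) (hf : Set.InjOn f S) : SumInjOn (fun x => g (f x)) S := by
  intro M hM M' hM' h
  have hmem : ∀ N : Multiset α, (∀ x ∈ N, x ∈ S) → ∀ y ∈ N.map f, y ∈ f '' S := by
    intro N hN y hy
    obtain ⟨x, hx, rfl⟩ := Multiset.mem_map.1 hy
    exact Set.mem_image_of_mem f (hN x hx)
  have hmap : M.map f = M'.map f :=
    hg (hmem M hM) (hmem M' hM') (by simpa only [Multiset.map_map, Function.comp_def] using h)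
  simpa only [Multiset.map_id'] using map_eq_map_of_forall_imp (g := fun x => x) (g' := fun x => x)
    (fun x hx y hy hxy => hf (hM x hx) (hM' y hy) hxy) hmap

theorem SumInjOn.image {α E : Type*} [AddCommMonoid E] {f : α → E} {S : Set α}
    (h : SumInjOn f S) : SumInjOn id (f '' S) := by
  have hlift : ∀ M : Multiset E, (∀ y ∈ M, y ∈ f '' S) →
      ∃ N : Multiset α, (∀ x ∈ N, x ∈ S) ∧ N.map f = M := by
    intro M hM
    choose g hgS hg using hM
    refine ⟨M.attach.map fun y => g y.1 y.2, fun x hx => ?_, ?_⟩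
    · obtain ⟨y, -, rfl⟩ := Multiset.mem_map.1 hx
      exact hgS y.1 y.2
    · simp only [Multiset.map_map, Function.comp_def, hg, Multiset.attach_map_val]
  intro M hM M' hM' hs
  obtain ⟨N, hN, rfl⟩ := hlift M hM
  obtain ⟨N', hN', rfl⟩ := hlift M' hM'
  rw [h hN hN' (by simpa using hs)]

theorem countable_setOf_multiset {α : Type*} {S : Set α} (hS : S.Countable) :
    {M : Multiset α | ∀ x ∈ M, x ∈ S}.Countable := by
  have := hS.to_subtype
  refine (Set.countable_range fun M : Multiset S => M.map Subtype.val).mono fun M hM => ?_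
  exact ⟨M.attach.map fun x => ⟨x.1, hM x.1 x.2⟩, by simp [Multiset.map_map]⟩

/-- A multiset as a formal sum of its elements with real coefficients. -/
noncomputable def formalSum {α : Type*} (M : Multiset α) : α →₀ ℝ :=
  open Classical in (Multiset.toFinsupp M).mapRange Nat.cast Nat.cast_zero

theorem formalSum_injective {α : Type*} : Function.Injective (formalSum (α := α)) := by
  classical
  exact (Finsupp.mapRange_injective _ _ Nat.cast_injective).comp Multiset.toFinsupp.injective

theorem formalSum_add {α : Type*} (M M' : Multiset α) :
    formalSum (M + M') = formalSum M + formalSum M' := by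
  classical
  rw [formalSum, map_add, Finsupp.mapRange_add Nat.cast_add]
  rfl

theorem linearCombination_formalSum {α : Type*} (f : α → ℝ) (M : Multiset α) :
    Finsupp.linearCombination ℝ f (formalSum M) = (M.map f).sum := by
  classical
  induction M using Multiset.induction_on with
  | empty => simp [formalSum]
  | cons a M ih =>
    rw [← Multiset.singleton_add, formalSum_add, map_add, ih, Multiset.map_add, Multiset.sum_add]
    simp [formalSum]

theorem sum_map_apply {α ι : Type*} (f : α → ι → ℝ) (M : Multiset α) (i : ι) :
    (M.map f).sum i = (M.map fun x => f x i).sum := by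
  rw [Pi.multiset_sum_apply, Multiset.map_map]
  rfl

namespace IsAnalyticSigmoidal

variable {σ : ℝ → ℝ} (hσ : IsAnalyticSigmoidal σ)
include hσ

theorem exists_mlp_sumInjOn_near {m : ℕ} {S : Set (Fin m → ℝ)} (hS : S.Countable)
    {f : (Fin m → ℝ) → ℝ} (hf : IsSingleUnit σ f) {η : ℝ} (hη : 0 < η) :
    ∃ g : MLP m 1, (∀ x, |g.eval σ x 0 - f x| < η) ∧ SumInjOn (g.eval σ) S := by
  obtain ⟨g, hg, hinj⟩ := hσ.exists_mlp_injOn_near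
    ((countable_setOf_multiset hS).image formalSum) hf hη
  refine ⟨g, hg, fun M hM M' hM' hs => formalSum_injective (hinj ⟨M, hM, rfl⟩ ⟨M', hM', rfl⟩ ?_)⟩
  simpa only [linearCombination_formalSum, sum_map_apply] using congrFun hs 0

theorem exists_mlp_sumInjOn {m : ℕ} {S : Set (Fin m → ℝ)} (hS : S.Countable) :
    ∃ g : MLP m 1, SumInjOn (g.eval σ) S :=
  let ⟨g, _, h⟩ := hσ.exists_mlp_sumInjOn_near hS (isSingleUnit_const σ 0) one_pos
  ⟨g, h⟩

end IsAnalyticSigmoidal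

/-! ### Colour refinement -/

theorem subset_of_antitone_of_stationary {X : Type*} [Fintype X] {R : ℕ → Set X}
    (hR : Antitone R) (hstep : ∀ t, R t ⊆ R (t + 1) → R (t + 1) ⊆ R (t + 2)) {T : ℕ}
    (hT : Fintype.card X ≤ T) (t : ℕ) : R T ⊆ R t := by
  have hmono : Monotone fun t => (R t)ᶜ.ncard := fun s t hst =>
    Set.ncard_le_ncard (Set.compl_subset_compl.2 (hR hst))
  have heq : ∀ {s t}, s ≤ t → (R s)ᶜ.ncard = (R t)ᶜ.ncard → R s = R t := fun hst h =>
    compl_injective (Set.eq_of_subset_of_ncard_le (Set.compl_subset_compl.2 (hR hst)) h.ge)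
  have hstab : ∀ n, Fintype.card X ≤ n → (R n)ᶜ.ncard = (R (Fintype.card X))ᶜ.ncard := fun n hn =>
    Nat.stabilises_of_monotone hmono
      (fun m => (Set.ncard_le_card _).trans_eq Nat.card_eq_fintype_card) (fun m h => by
        have hm := hstep m (heq (Nat.le_succ m) h).subset
        rw [hm.antisymm (hR (Nat.le_succ _))]) hn
  rcases le_total t T with h | h
  · exact hR h
  · exact (heq h ((hstab T hT).trans (hstab t (hT.trans h)).symm)).subset

open Classical in
/-- The neighbours of a node, as a multiset. -/
noncomputable def nbrs {V : Type} [Fintype V] (G : SimpleGraph V) (v : V) : Multiset V :=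
  (Finset.univ.filter (fun u => G.Adj v u)).val

theorem mem_nbrs {V : Type} [Fintype V] {G : SimpleGraph V} {u v : V} :
    u ∈ nbrs G v ↔ G.Adj v u := by
  simp [nbrs]

theorem nbrs_eq_zero_iff {V : Type} [Fintype V] {G : SimpleGraph V} {v : V} :
    nbrs G v = 0 ↔ v ∉ G.support := by
  simp only [Multiset.eq_zero_iff_forall_notMem, mem_nbrs, SimpleGraph.mem_support, not_exists]

section WL

variable {V V' X Y : Type} [Fintype V] [Fintype V'] {G : SimpleGraph V} {G' : SimpleGraph V'}

theorem wlColor_succ_eq_iff {x : V → X} {x' : V' → X} {t : ℕ} {u : V} {v : V'} :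
    wlColor G x (t + 1) u = wlColor G' x' (t + 1) v ↔
      wlColor G x t u = wlColor G' x' t v ∧
        (nbrs G u).map (wlColor G x t) = (nbrs G' v).map (wlColor G' x' t) :=
  Prod.mk_inj

theorem wlColor_add_eq_of_imp {x : V → X} {x' : V' → X} {y : V → Y} {y' : V' → Y} {s : ℕ}
    (h : ∀ u v, y u = y' v → wlColor G x s u = wlColor G' x' s v) {t : ℕ} {u : V} {v : V'}
    (huv : wlColor G y t u = wlColor G' y' t v) :
    wlColor G x (s + t) u = wlColor G' x' (s + t) v := by
  induction t generalizing u v with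
  | zero => exact h u v huv
  | succ t ih =>
    rw [wlColor_succ_eq_iff] at huv
    exact wlColor_succ_eq_iff.2 ⟨ih huv.1, map_eq_map_of_forall_imp (fun _ _ _ _ => ih) huv.2⟩

theorem wlColor_eq_of_card_mul_card_le {x : V → X} {x' : V' → X} {T : ℕ}
    (hT : Fintype.card V * Fintype.card V' ≤ T) (t : ℕ) {u : V} {v : V'}
    (h : wlColor G x T u = wlColor G' x' T v) : wlColor G x t u = wlColor G' x' t v := by
  have hsub := subset_of_antitone_of_stationary (X := V × V') (T := T)
    (R := fun t => {p | wlColor G x t p.1 = wlColor G' x' t p.2})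
    (antitone_nat_of_succ_le fun t p hp => (wlColor_succ_eq_iff.1 hp).1)
    (fun t ht p hp => wlColor_succ_eq_iff.2 ⟨hp, map_eq_map_of_forall_imp
      (fun a _ b _ hab => @ht (a, b) hab) (wlColor_succ_eq_iff.1 hp).2⟩)
    (by rwa [Fintype.card_prod]) t
  exact @hsub (u, v) h

theorem wlColor_eq_of_isolated {x : V → X} {x' : V' → X} {u : V} {v : V'}
    (hu : u ∉ G.support) (hv : v ∉ G'.support) (h : x u = x' v) (t : ℕ) :
    wlColor G x t u = wlColor G' x' t v := by
  induction t with
  | zero => exact h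
  | succ t ih =>
    refine wlColor_succ_eq_iff.2 ⟨ih, ?_⟩
    rw [nbrs_eq_zero_iff.2 hu, nbrs_eq_zero_iff.2 hv, Multiset.map_zero, Multiset.map_zero]

theorem wlColor_eq_of_regular {x : V → X} {x' : V' → X} {d : ℕ} (hG : ∀ u, (nbrs G u).card = d)
    (hG' : ∀ u, (nbrs G' u).card = d) (h : ∀ u v, x u = x' v) (t : ℕ) (u : V) (v : V') :
    wlColor G x t u = wlColor G' x' t v := by
  induction t generalizing u v with
  | zero => exact h u v
  | succ t ih =>
    refine wlColor_succ_eq_iff.2 ⟨ih u v, ?_⟩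
    refine map_eq_map_of_forall_imp (f := fun _ => ()) (f' := fun _ => ())
      (fun a _ b _ _ => ih a b) ?_
    rw [Multiset.map_const', Multiset.map_const', hG, hG']

theorem card_snd_wlColor_succ (x : V → X) (t : ℕ) (u : V) :
    (wlColor G x (t + 1) u).2.card = (nbrs G u).card :=
  Multiset.card_map _ _

theorem not_wlDistinguishes {N : ℕ} {G H : FGraph N} {T : ℕ} (hT : G.order * H.order ≤ T)
    (h : (Finset.univ : Finset (Fin G.order)).val.map (wlColor G.graph G.feat T) =
      (Finset.univ : Finset (Fin H.order)).val.map (wlColor H.graph H.feat T)) :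
    ¬ WLDistinguishes G H := by
  rintro ⟨t, ht⟩
  exact ht (map_eq_map_of_forall_imp
    (fun a _ b _ => wlColor_eq_of_card_mul_card_le (by simpa only [Fintype.card_fin] using hT) t) h)

end WL

/-! ### Graph isomorphism networks -/

section JointRange

variable {I : Type} {V : I → Type} {α β : Type}

/-- All values of a family of functions. It is used for the colourings of a family of graphs. -/
def jointRange (x : ∀ i, V i → α) : Set α := Set.range fun p : Σ i, V i => x p.1 p.2

theorem mem_jointRange (x : ∀ i, V i → α) (i : I) (v : V i) : x i v ∈ jointRange x :=
  ⟨⟨i, v⟩, rfl⟩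

theorem countable_jointRange [Countable I] [∀ i, Countable (V i)] (x : ∀ i, V i → α) :
    (jointRange x).Countable :=
  Set.countable_range _

theorem jointRange_comp (x : ∀ i, V i → α) (f : α → β) :
    jointRange (fun i v => f (x i v)) = f '' jointRange x := by
  rw [jointRange, jointRange, ← Set.range_comp]
  rfl

theorem map_eq_map_of_sum_eq [AddCommMonoid α] {x : ∀ i, V i → α}
    (hx : SumInjOn id (jointRange x)) {i j : I} {M : Multiset (V i)} {M' : Multiset (V j)}
    (h : (M.map (x i)).sum = (M'.map (x j)).sum) : M.map (x i) = M'.map (x j) := by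
  refine hx (fun y hy => ?_) (fun y hy => ?_) (by simpa only [Multiset.map_id] using h) <;>
  · obtain ⟨w, -, rfl⟩ := Multiset.mem_map.1 hy
    exact mem_jointRange x _ w

end JointRange

theorem ginAggregate_eq {V : Type} [Fintype V] (G : SimpleGraph V) {a : ℕ} (ε : ℝ)
    (x : V → (Fin a → ℝ)) (v : V) :
    ginAggregate G ε x v = (1 + ε) • x v + ((nbrs G v).map x).sum := rfl

instance {a b : ℕ} : Inhabited (GIN a b) := ⟨⟨0, default, .one 0 default⟩⟩

section GIN

variable {I : Type} {V : I → Type} [Countable I] [∀ i, Fintype (V i)]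

theorem exists_eps_ginAggregate (G : ∀ i, SimpleGraph (V i)) {a : ℕ} (x : ∀ i, V i → (Fin a → ℝ))
    (l : ℝ) :
    ∃ ε, l < 1 + ε ∧ ∀ {i j u v}, ginAggregate (G i) ε (x i) u = ginAggregate (G j) ε (x j) v →
      x i u = x j v ∧ ((nbrs (G i) u).map (x i)).sum = ((nbrs (G j) v).map (x j)).sum := by
  obtain ⟨t, hlt, -, ht⟩ := exists_smul_add_injOn
    (countable_jointRange fun i v => (x i v, ((nbrs (G i) v).map (x i)).sum)) (lt_add_one l)
  refine ⟨t - 1, by linarith, fun {i j u v} h => ?_⟩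
  simp only [ginAggregate_eq, add_sub_cancel] at h
  exact Prod.mk_inj.1 (ht (mem_jointRange _ i u) (mem_jointRange _ j v) h)

variable {σ : ℝ → ℝ} (hσ : IsAnalyticSigmoidal σ)
include hσ

theorem IsAnalyticSigmoidal.exists_ginLayer (G : ∀ i, SimpleGraph (V i)) {a : ℕ}
    (x : ∀ i, V i → (Fin a → ℝ)) (hx : SumInjOn id (jointRange x)) :
    ∃ (ε : ℝ) (g : MLP a 1),
      SumInjOn id (jointRange fun i v => g.eval σ (ginAggregate (G i) ε (x i) v)) ∧
      ∀ {i j u v}, g.eval σ (ginAggregate (G i) ε (x i) u) =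
          g.eval σ (ginAggregate (G j) ε (x j) v) →
        wlColor (G i) (x i) 1 u = wlColor (G j) (x j) 1 v := by
  obtain ⟨ε, -, hε⟩ := exists_eps_ginAggregate G x 0
  obtain ⟨g, hg⟩ := hσ.exists_mlp_sumInjOn
    (countable_jointRange fun i => ginAggregate (G i) ε (x i))
  refine ⟨ε, g, ?_, fun {i j u v} h => ?_⟩
  · rw [jointRange_comp (fun i => ginAggregate (G i) ε (x i))]
    exact hg.image
  · obtain ⟨hcolor, hsum⟩ := hε (hg.injOn (mem_jointRange _ i u) (mem_jointRange _ j v) h)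
    exact wlColor_succ_eq_iff.2 ⟨hcolor, map_eq_map_of_sum_eq hx hsum⟩

theorem IsAnalyticSigmoidal.exists_ginLayers (G : ∀ i, SimpleGraph (V i)) (T : ℕ) {a : ℕ}
    (x : ∀ i, V i → (Fin a → ℝ)) (hx : SumInjOn id (jointRange x)) :
    ∃ L : GINLayers a 1, SumInjOn id (jointRange fun i => L.eval σ (G i) (x i)) ∧
      ∀ {i j u v}, L.eval σ (G i) (x i) u = L.eval σ (G j) (x j) v →
        wlColor (G i) (x i) (T + 1) u = wlColor (G j) (x j) (T + 1) v := by
  induction T generalizing a x with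
  | zero =>
    obtain ⟨ε, g, hg, hgwl⟩ := hσ.exists_ginLayer G x hx
    exact ⟨.one ε g, hg, hgwl⟩
  | succ T ih =>
    obtain ⟨ε, g, hg, hgwl⟩ := hσ.exists_ginLayer G x hx
    obtain ⟨L, hL, hLwl⟩ := ih (fun i v => g.eval σ (ginAggregate (G i) ε (x i) v)) hg
    refine ⟨.cons ε g L, hL, fun h => ?_⟩
    rw [add_comm]
    exact wlColor_add_eq_of_imp (fun _ _ => hgwl) (hLwl h)

theorem IsAnalyticSigmoidal.exists_gin (G : ∀ i, SimpleGraph (V i)) (T : ℕ) {a : ℕ}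
    (x : ∀ i, V i → (Fin a → ℝ)) :
    ∃ P : GIN a 1, SumInjOn id (jointRange fun i => P.eval σ (G i) (x i)) ∧
      ∀ {i j u v}, P.eval σ (G i) (x i) u = P.eval σ (G j) (x j) v →
        wlColor (G i) (x i) (T + 1) u = wlColor (G j) (x j) (T + 1) v := by
  obtain ⟨g, hg⟩ := hσ.exists_mlp_sumInjOn (countable_jointRange x)
  obtain ⟨L, hL, hLwl⟩ := hσ.exists_ginLayers G T (fun i v => g.eval σ (x i v))
    (jointRange_comp x (g.eval σ) ▸ hg.image)
  refine ⟨⟨1, g, L⟩, hL, fun {i j u v} h => ?_⟩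
  rw [← zero_add (T + 1)]
  exact wlColor_add_eq_of_imp
    (fun u v => hg.injOn (mem_jointRange x i u) (mem_jointRange x j v)) (hLwl h)

end GIN

/-! ### Folklore refinement and higher-order refinement -/

/-- Colours after `t` rounds of the folklore two-dimensional refinement, the nested pairs and
multisets which `folkloreColor` produces. -/
def FolkloreColor (X : Type) : ℕ → Type
  | 0 => X
  | t + 1 => FolkloreColor X t × Multiset (FolkloreColor X t × FolkloreColor X t)

/-- The folklore two-dimensional refinement of a colouring of pairs of nodes, in which a pair
`(u, v)` sees the colours of the pairs `(u, w)` and `(w, v)` jointly. A round of it is what a block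
of PPGN can compute, and it refines as much as three-dimensional WL. -/
noncomputable def folkloreColor {V X : Type} [Fintype V] (y : V → V → X) :
    (t : ℕ) → V → V → FolkloreColor X t
  | 0 => y
  | t + 1 => fun u v => (folkloreColor y t u v, (Finset.univ : Finset V).val.map
      fun w => (folkloreColor y t u w, folkloreColor y t w v))

section Refinement

variable {V V' X Y : Type} [Fintype V] [Fintype V']

theorem folkloreColor_succ_eq_iff {y : V → V → X} {y' : V' → V' → X} {t : ℕ} {u v : V}
    {u' v' : V'} :
    folkloreColor y (t + 1) u v = folkloreColor y' (t + 1) u' v' ↔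
      folkloreColor y t u v = folkloreColor y' t u' v' ∧
        (Finset.univ : Finset V).val.map
            (fun w => (folkloreColor y t u w, folkloreColor y t w v)) =
          (Finset.univ : Finset V').val.map
            (fun w => (folkloreColor y' t u' w, folkloreColor y' t w v')) :=
  Prod.mk_inj

theorem folkloreColor_add_eq_of_imp {x : V → V → X} {x' : V' → V' → X} {y : V → V → Y}
    {y' : V' → V' → Y} {s : ℕ}
    (h : ∀ u v u' v', y u v = y' u' v' → folkloreColor x s u v = folkloreColor x' s u' v')
    {t : ℕ} {u v : V} {u' v' : V'} (huv : folkloreColor y t u v = folkloreColor y' t u' v') :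
    folkloreColor x (s + t) u v = folkloreColor x' (s + t) u' v' := by
  induction t generalizing u v u' v' with
  | zero => exact h u v u' v' huv
  | succ t ih =>
    rw [folkloreColor_succ_eq_iff] at huv
    refine folkloreColor_succ_eq_iff.2
      ⟨ih huv.1, map_eq_map_of_forall_imp (fun a _ b _ hab => ?_) huv.2⟩
    rw [Prod.mk_inj] at hab ⊢
    exact ⟨ih hab.1, ih hab.2⟩

theorem folkloreColor_zero_eq {y : V → V → X} {y' : V' → V' → X} {t : ℕ} {u v : V} {u' v' : V'}
    (h : folkloreColor y t u v = folkloreColor y' t u' v') : y u v = y' u' v' := by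
  induction t with
  | zero => exact h
  | succ t ih => exact ih (folkloreColor_succ_eq_iff.1 h).1

theorem folkloreColor_swap {y : V → V → X} {y' : V' → V' → X} (hy : ∀ u v, y u v = y v u)
    (hy' : ∀ u v, y' u v = y' v u) {t : ℕ} {u v : V} {u' v' : V'}
    (h : folkloreColor y t u v = folkloreColor y' t u' v') :
    folkloreColor y t v u = folkloreColor y' t v' u' := by
  induction t generalizing u v u' v' with
  | zero => exact (hy v u).trans (Eq.trans h (hy' u' v'))
  | succ t ih =>
    rw [folkloreColor_succ_eq_iff] at h ⊢
    refine ⟨ih h.1, map_eq_map_of_forall_imp (fun a _ b _ hab => ?_) h.2⟩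
    rw [Prod.mk_inj] at hab ⊢
    exact ⟨ih hab.2, ih hab.1⟩

theorem kwlColor_zero_eq_iff {k : ℕ} {G : SimpleGraph V} {G' : SimpleGraph V'} {x : V → X}
    {x' : V' → X} {p : Fin k → V} {q : Fin k → V'} :
    kwlColor k G x 0 p = kwlColor k G' x' 0 q ↔ (∀ i, x (p i) = x' (q i)) ∧
      (∀ i j, p i = p j ↔ q i = q j) ∧ ∀ i j, G.Adj (p i) (p j) ↔ G'.Adj (q i) (q j) := by
  refine Prod.mk_inj.trans (and_congr funext_iff (Prod.mk_inj.trans ?_))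
  simp only [funext_iff, eq_iff_iff]

theorem kwlColor_succ_eq_iff {k : ℕ} {G : SimpleGraph V} {G' : SimpleGraph V'} {x : V → X}
    {x' : V' → X} {t : ℕ} {p : Fin k → V} {q : Fin k → V'} :
    kwlColor k G x (t + 1) p = kwlColor k G' x' (t + 1) q ↔
      kwlColor k G x t p = kwlColor k G' x' t q ∧ ∀ j,
        (Finset.univ : Finset V).val.map (fun u => kwlColor k G x t (Function.update p j u)) =
        (Finset.univ : Finset V').val.map
          (fun u => kwlColor k G' x' t (Function.update q j u)) :=
  Prod.mk_inj.trans (and_congr_right fun _ => funext_iff)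

theorem kwlColor_eq_of_card_mul_card_le {k : ℕ} {G : SimpleGraph V} {G' : SimpleGraph V'}
    {x : V → X} {x' : V' → X} {T : ℕ} (hT : Fintype.card V ^ k * Fintype.card V' ^ k ≤ T)
    (t : ℕ) {p : Fin k → V} {q : Fin k → V'} (h : kwlColor k G x T p = kwlColor k G' x' T q) :
    kwlColor k G x t p = kwlColor k G' x' t q := by
  have hsub := subset_of_antitone_of_stationary (X := (Fin k → V) × (Fin k → V')) (T := T)
    (R := fun t => {p | kwlColor k G x t p.1 = kwlColor k G' x' t p.2})
    (antitone_nat_of_succ_le fun t p hp => (kwlColor_succ_eq_iff.1 hp).1)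
    (fun t ht p hp => kwlColor_succ_eq_iff.2 ⟨hp, fun j => map_eq_map_of_forall_imp
      (fun a _ b _ hab => by exact @ht (Function.update p.1 j a, Function.update p.2 j b) hab)
      ((kwlColor_succ_eq_iff.1 hp).2 j)⟩)
    (by simpa using hT) t
  exact @hsub (p, q) h

theorem not_kwlDistinguishes {N k : ℕ} {G H : FGraph N} {T : ℕ}
    (hT : G.order ^ k * H.order ^ k ≤ T)
    (h : (Finset.univ : Finset (Fin k → Fin G.order)).val.map (kwlColor k G.graph G.feat T) =
      (Finset.univ : Finset (Fin k → Fin H.order)).val.map (kwlColor k H.graph H.feat T)) :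
    ¬ KWLDistinguishes k G H := by
  rintro ⟨t, ht⟩
  exact ht (map_eq_map_of_forall_imp (fun p _ q _ =>
    kwlColor_eq_of_card_mul_card_le (by simpa only [Fintype.card_fin] using hT) t) h)

end Refinement

theorem append_eq_append_iff {α : Type*} {m n : ℕ} {x x' : Fin m → α} {y y' : Fin n → α} :
    Fin.append x y = Fin.append x' y' ↔ x = x' ∧ y = y' :=
  (Fin.appendEquiv m n).injective.eq_iff (a := (x, y)) (b := (x', y')).trans Prod.mk_inj

theorem sum_append {ι α : Type*} [AddCommMonoid α] {m n : ℕ} (s : Finset ι) (f : ι → Fin m → α)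
    (g : ι → Fin n → α) :
    ∑ i ∈ s, Fin.append (f i) (g i) = Fin.append (∑ i ∈ s, f i) (∑ i ∈ s, g i) := by
  ext k
  induction k using Fin.addCases <;> simp only [Finset.sum_apply, Fin.append_left, Fin.append_right]

section Input

variable {V V' : Type} {N : ℕ} {G : SimpleGraph V} {G' : SimpleGraph V'} {x : V → (Fin N → ℝ)}
  {x' : V' → (Fin N → ℝ)}

theorem adj_eq_and_feat_eq_of_ppgnInput_eq {u v : V} {u' v' : V'}
    (h : ppgnInput G x u v = ppgnInput G' x' u' v') :
    (u = v ↔ u' = v') ∧ (G.Adj u v ↔ G'.Adj u' v') ∧ (u = v → x u = x' u') := by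
  classical
  obtain ⟨hfeat, hbits⟩ := append_eq_append_iff.1 h
  have hite : ∀ p q : Prop, ∀ [Decidable p] [Decidable q],
      (if p then (1 : ℝ) else 0) = (if q then 1 else 0) → (p ↔ q) := by
    intro p q _ _ hpq
    by_cases hp : p <;> by_cases hq : q <;> simp_all
  have heq : u = v ↔ u' = v' := hite _ _ (congrFun hbits 1)
  refine ⟨heq, hite _ _ (congrFun hbits 0), fun huv => ?_⟩
  rwa [if_pos huv, if_pos (heq.1 huv)] at hfeat

theorem ppgnInput_symm (u v : V) : ppgnInput G x u v = ppgnInput G x v u := by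
  by_cases h : u = v
  · rw [h]
  · by_cases hadj : G.Adj u v
    · simp only [ppgnInput, h, Ne.symm h, if_false, hadj, hadj.symm]
    · simp only [ppgnInput, h, Ne.symm h, if_false, hadj, mt SimpleGraph.Adj.symm hadj]

variable [Fintype V] [Fintype V']

theorem folkloreColor_diag {t : ℕ} {u v : V} {u' v' : V'}
    (h : folkloreColor (ppgnInput G x) (t + 1) u v =
      folkloreColor (ppgnInput G' x') (t + 1) u' v') :
    folkloreColor (ppgnInput G x) t u u = folkloreColor (ppgnInput G' x') t u' u' := by
  have hmem : (folkloreColor (ppgnInput G x) t u u, folkloreColor (ppgnInput G x) t u v) ∈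
      (Finset.univ : Finset V).val.map (fun w =>
        (folkloreColor (ppgnInput G x) t u w, folkloreColor (ppgnInput G x) t w v)) :=
    Multiset.mem_map.2 ⟨u, Finset.mem_univ_val _, rfl⟩
  rw [(folkloreColor_succ_eq_iff.1 h).2] at hmem
  obtain ⟨w, -, hw⟩ := Multiset.mem_map.1 hmem
  have hw := (Prod.mk_inj.1 hw).1
  have hdiag : u' = w :=
    ((adj_eq_and_feat_eq_of_ppgnInput_eq (folkloreColor_zero_eq hw)).1).2 rfl
  rw [← hw, ← hdiag]

theorem kwlColor_zero_eq_of_folkloreColor {k : ℕ} [Nontrivial (Fin k)] {p : Fin k → V}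
    {q : Fin k → V'} (h : ∀ i j, i ≠ j → folkloreColor (ppgnInput G x) 1 (p i) (p j) =
      folkloreColor (ppgnInput G' x') 1 (q i) (q j)) :
    kwlColor k G x 0 p = kwlColor k G' x' 0 q := by
  have hpair := fun i j hij =>
    adj_eq_and_feat_eq_of_ppgnInput_eq (folkloreColor_zero_eq (h i j hij))
  refine kwlColor_zero_eq_iff.2 ⟨fun i => ?_, fun i j => ?_, fun i j => ?_⟩
  · obtain ⟨j, hj⟩ := exists_ne i
    exact (adj_eq_and_feat_eq_of_ppgnInput_eq
      (folkloreColor_zero_eq (folkloreColor_diag (h i j hj.symm)))).2.2 rfl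
  · rcases eq_or_ne i j with rfl | hij
    · simp only
    · exact (hpair i j hij).1
  · rcases eq_or_ne i j with rfl | hij
    · simp only [SimpleGraph.irrefl]
    · exact (hpair i j hij).2.1

theorem kwlColor_eq_of_folkloreColor {t : ℕ} {p : Fin 3 → V} {q : Fin 3 → V'}
    (h : ∀ i j, i ≠ j → folkloreColor (ppgnInput G x) (t + 1) (p i) (p j) =
      folkloreColor (ppgnInput G' x') (t + 1) (q i) (q j)) :
    kwlColor 3 G x t p = kwlColor 3 G' x' t q := by
  induction t generalizing p q with
  | zero => exact kwlColor_zero_eq_of_folkloreColor h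
  | succ t ih =>
    have hpred : ∀ i j, i ≠ j → folkloreColor (ppgnInput G x) (t + 1) (p i) (p j) =
        folkloreColor (ppgnInput G' x') (t + 1) (q i) (q j) :=
      fun i j hij => (folkloreColor_succ_eq_iff.1 (h i j hij)).1
    refine kwlColor_succ_eq_iff.2 ⟨ih hpred, fun j => ?_⟩
    -- A node replacing the entry `j` is seen by the pair of the two other entries.
    obtain ⟨a, b, ha, hb, hab, hall⟩ :
        ∃ a b : Fin 3, a ≠ j ∧ b ≠ j ∧ a ≠ b ∧ ∀ i, i = j ∨ i = a ∨ i = b := by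
      revert j; decide
    refine map_eq_map_of_forall_imp (fun w _ w' _ hw => ih fun i k hik => ?_)
      (folkloreColor_succ_eq_iff.1 (h a b hab)).2
    obtain ⟨haw, hwb⟩ := Prod.mk_inj.1 hw
    have hwa := folkloreColor_swap ppgnInput_symm ppgnInput_symm haw
    have hbw := folkloreColor_swap ppgnInput_symm ppgnInput_symm hwb
    rcases hall i with rfl | rfl | rfl <;> rcases hall k with rfl | rfl | rfl <;>
      simp_all [Function.update_of_ne]

theorem map_univ_eq_sum {α β : Type*} [Fintype α] (f : α → β) :
    (Finset.univ : Finset α).val.map f = ∑ a, {f a} := by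
  have := Multiset.sum_map_singleton ((Finset.univ : Finset α).val.map f)
  rw [Multiset.map_map] at this
  exact this.symm

theorem map_univ_triples {β : Type*} (f : (Fin 3 → V) → β) :
    (Finset.univ : Finset (Fin 3 → V)).val.map f = ∑ u, ∑ v, ∑ w, {f ![u, v, w]} := by
  simp only [map_univ_eq_sum, ← (Fin.consEquiv fun _ => V).sum_comp, Fintype.sum_prod_type,
    Finset.univ_unique, Finset.sum_singleton]
  rfl

theorem sum_univ_eq_of_forall_imp {γ δ : Type*} [AddCommMonoid δ] {f : V → γ} {f' : V' → γ}
    {g : V → δ} {g' : V' → δ} (h : ∀ a b, f a = f' b → g a = g' b)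
    (hf : (Finset.univ : Finset V).val.map f = (Finset.univ : Finset V').val.map f') :
    ∑ a, g a = ∑ b, g' b :=
  congrArg Multiset.sum (map_eq_map_of_forall_imp (fun a _ b _ => h a b) hf)

theorem map_kwlColor_eq_of_folkloreColor {t : ℕ}
    (h : (Finset.univ : Finset V).val.map (fun u => folkloreColor (ppgnInput G x) (t + 3) u u) =
      (Finset.univ : Finset V').val.map (fun u => folkloreColor (ppgnInput G' x') (t + 3) u u)) :
    (Finset.univ : Finset (Fin 3 → V)).val.map (kwlColor 3 G x t) =
      (Finset.univ : Finset (Fin 3 → V')).val.map (kwlColor 3 G' x' t) := by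
  rw [map_univ_triples, map_univ_triples]
  refine sum_univ_eq_of_forall_imp (fun u u' hu => ?_) h
  refine sum_univ_eq_of_forall_imp (fun v v' hv => ?_) (folkloreColor_succ_eq_iff.1 hu).2
  have huv_succ := (Prod.mk_inj.1 hv).1
  refine sum_univ_eq_of_forall_imp (fun w w' hw => ?_) (folkloreColor_succ_eq_iff.1 huv_succ).2
  have huv := (folkloreColor_succ_eq_iff.1 huv_succ).1
  obtain ⟨huw, hwv⟩ := Prod.mk_inj.1 hw
  have hwu := folkloreColor_swap ppgnInput_symm ppgnInput_symm huw
  have hvw := folkloreColor_swap ppgnInput_symm ppgnInput_symm hwv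
  have hvu := folkloreColor_swap ppgnInput_symm ppgnInput_symm huv
  rw [Multiset.singleton_inj]
  refine kwlColor_eq_of_folkloreColor fun i j hij => ?_
  fin_cases i <;> fin_cases j <;> first | exact absurd rfl hij | assumption

end Input

/-! ### Provably powerful graph networks -/

theorem linearCombination_mul {α β : Type*} (f : α → ℝ) (g : β → ℝ) (c : α × β →₀ ℝ) :
    Finsupp.linearCombination ℝ (fun p : α × β => f p.1 * g p.2) c =
      Finsupp.linearCombination ℝ f
        (c.curry.mapRange (Finsupp.linearCombination ℝ g) (map_zero _)) := by
  rw [Finsupp.linearCombination_apply, Finsupp.linearCombination_apply,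
    Finsupp.sum_mapRange_index (by simp),
    ← Finsupp.sum_curry_index c (fun x y a => a • (f x * g y))]
  refine Finsupp.sum_congr fun x _ => ?_
  rw [Finsupp.linearCombination_apply, Finsupp.sum, Finsupp.sum, Finset.sum_smul]
  refine Finset.sum_congr rfl fun y _ => ?_
  simp only [smul_eq_mul]
  ring

/-- The rows of the formal sums are separated by `m₂`, and then the formal sums themselves, with
every row replaced by its value under `m₂`, are separated by `m₁`. -/
theorem IsAnalyticSigmoidal.exists_mlp_mul_sumInjOn {σ : ℝ → ℝ} (hσ : IsAnalyticSigmoidal σ)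
    {a : ℕ} {S : Set (Fin a → ℝ)} (hS : S.Countable) :
    ∃ m₁ m₂ : MLP a 1, SumInjOn
      (fun p : (Fin a → ℝ) × (Fin a → ℝ) => m₁.eval σ p.1 0 * m₂.eval σ p.2 0) (S ×ˢ S) := by
  set C : Set ((Fin a → ℝ) × (Fin a → ℝ) →₀ ℝ) := formalSum '' {M | ∀ p ∈ M, p ∈ S ×ˢ S}
  have hC : C.Countable := (countable_setOf_multiset (hS.prod hS)).image formalSum
  obtain ⟨m₂, -, hm₂⟩ := hσ.exists_mlp_injOn_near
    (hC.biUnion fun c _ => (Finsupp.finite_range c.curry).countable) (isSingleUnit_const σ 0)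
    one_pos
  set rowValues := fun c : (Fin a → ℝ) × (Fin a → ℝ) →₀ ℝ =>
    c.curry.mapRange (Finsupp.linearCombination ℝ fun x => m₂.eval σ x 0) (map_zero _)
  have hrows : Set.InjOn rowValues C := fun c hc c' hc' h =>
    Finsupp.curryEquiv.injective <| Finsupp.ext fun x =>
      hm₂ (Set.mem_biUnion hc ⟨x, rfl⟩) (Set.mem_biUnion hc' ⟨x, rfl⟩) (DFunLike.congr_fun h x)
  obtain ⟨m₁, -, hm₁⟩ := hσ.exists_mlp_injOn_near (hC.image rowValues) (isSingleUnit_const σ 0)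
    one_pos
  refine ⟨m₁, m₂, fun M hM M' hM' hs => formalSum_injective ?_⟩
  refine hrows ⟨M, hM, rfl⟩ ⟨M', hM', rfl⟩ (hm₁ ⟨_, ⟨M, hM, rfl⟩, rfl⟩ ⟨_, ⟨M', hM', rfl⟩, rfl⟩ ?_)
  rw [← linearCombination_mul, ← linearCombination_mul, linearCombination_formalSum,
    linearCombination_formalSum]
  exact hs

section PPGN

variable {I : Type} [Countable I] {V : I → Type} [∀ i, Fintype (V i)] {σ : ℝ → ℝ}
  (hσ : IsAnalyticSigmoidal σ)
include hσ

theorem IsAnalyticSigmoidal.exists_ppgnBlock {a : ℕ} (Y : ∀ i, V i → V i → (Fin a → ℝ)) :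
    ∃ B : PPGNBlock a 1 1,
      (∀ i j u v u' v', B.eval σ (Y i) u v = B.eval σ (Y j) u' v' →
        folkloreColor (Y i) 1 u v = folkloreColor (Y j) 1 u' v') ∧
      ∀ i j, ∑ u, B.eval σ (Y i) u u = ∑ u, B.eval σ (Y j) u u →
        (Finset.univ : Finset (V i)).val.map (fun u => Y i u u) =
          (Finset.univ : Finset (V j)).val.map (fun u => Y j u u) := by
  set S : Set (Fin a → ℝ) := jointRange (V := fun i => V i × V i) fun i p => Y i p.1 p.2
  have hS : S.Countable := countable_jointRange _
  have hmem : ∀ i u v, Y i u v ∈ S := fun i u v => ⟨⟨i, u, v⟩, rfl⟩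
  obtain ⟨m₁, m₂, hm⟩ := hσ.exists_mlp_mul_sumInjOn hS
  obtain ⟨m₃, hm₃⟩ := hσ.exists_mlp_sumInjOn hS
  refine ⟨⟨m₁, m₂, m₃⟩, fun i j u v u' v' h => ?_, fun i j h => ?_⟩
  · obtain ⟨hdirect, hprod⟩ := append_eq_append_iff.1 h
    have hpairs : (Finset.univ : Finset (V i)).val.map (fun w => (Y i u w, Y i w v)) =
        (Finset.univ : Finset (V j)).val.map (fun w => (Y j u' w, Y j w v')) :=
      hm (Multiset.forall_mem_map_iff.2 fun w _ => ⟨hmem i u w, hmem i w v⟩)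
        (Multiset.forall_mem_map_iff.2 fun w _ => ⟨hmem j u' w, hmem j w v'⟩)
        (by simpa only [Multiset.map_map, Function.comp_apply, Finset.sum_map_val]
          using congrFun hprod 0)
    exact folkloreColor_succ_eq_iff.2 ⟨hm₃.injOn (hmem _ _ _) (hmem _ _ _) hdirect, hpairs⟩
  · simp only [PPGNBlock.eval, sum_append] at h
    refine hm₃ (Multiset.forall_mem_map_iff.2 fun w _ => hmem i w w)
      (Multiset.forall_mem_map_iff.2 fun w _ => hmem j w w) ?_
    simpa only [Multiset.map_map, Function.comp_apply, Finset.sum_map_val]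
      using (append_eq_append_iff.1 h).1

theorem IsAnalyticSigmoidal.exists_ppgn (T : ℕ) {a : ℕ} (Y : ∀ i, V i → V i → (Fin a → ℝ)) :
    ∃ P : PPGN a 2, ∀ i j, ∑ u, P.eval σ (Y i) u u = ∑ u, P.eval σ (Y j) u u →
      (Finset.univ : Finset (V i)).val.map (fun u => folkloreColor (Y i) T u u) =
        (Finset.univ : Finset (V j)).val.map (fun u => folkloreColor (Y j) T u u) := by
  induction T generalizing a with
  | zero =>
    obtain ⟨B, -, hB⟩ := hσ.exists_ppgnBlock Y
    exact ⟨.one B, hB⟩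
  | succ T ih =>
    obtain ⟨B, hB, -⟩ := hσ.exists_ppgnBlock Y
    obtain ⟨P, hP⟩ := ih fun i => B.eval σ (Y i)
    refine ⟨.cons B P, fun i j h => ?_⟩
    rw [add_comm T 1]
    exact map_eq_map_of_forall_imp
      (fun u _ u' _ => folkloreColor_add_eq_of_imp (hB i j)) (hP i j h)

end PPGN
/-! ### Homology of one-dimensional simplicial complexes -/

theorem finrank_map_add_finrank_inf_ker {F U W : Type*} [Field F] [AddCommGroup U] [Module F U]
    [AddCommGroup W] [Module F W] [FiniteDimensional F U] (S : Submodule F U) (f : U →ₗ[F] W) :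
    Module.finrank F (S.map f) + Module.finrank F (S ⊓ LinearMap.ker f : Submodule F U) =
      Module.finrank F S := by
  rw [← LinearMap.finrank_range_add_finrank_ker (f.domRestrict S), LinearMap.range_domRestrict,
    LinearMap.ker_domRestrict, ← Submodule.finrank_map_subtype_eq, Submodule.map_comap_subtype]

theorem finrank_supported (F : Type*) [Field F] {α : Type*} [Finite α] (S : Set α) :
    Module.finrank F (Finsupp.supported F F S) = S.ncard := by
  classical
  cases nonempty_fintype α
  rw [(Finsupp.supportedEquivFinsupp S).finrank_eq, Module.finrank_finsupp_self,
    Set.ncard_eq_toFinset_card', Set.toFinset_card]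

section Homology

variable {F : Type} [Field F] {V : Type} {K L : PreAbstractSimplicialComplex V}

theorem simplicialChains_mono (n : ℕ) (h : K ≤ L) :
    simplicialChains F n K ≤ simplicialChains F n L :=
  Finsupp.supported_mono fun _ hs => ⟨h hs.1, hs.2⟩

theorem simplicialChains_eq_bot {n : ℕ} (h : ∀ s ∈ K.faces, s.card ≠ n + 1) :
    simplicialChains F n K = ⊥ := by
  have hempty : {s | s ∈ K.faces ∧ s.card = n + 1} = ∅ :=
    Set.eq_empty_of_forall_notMem fun s hs => h s hs.1 hs.2
  rw [simplicialChains, hempty, Finsupp.supported_empty]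

theorem persistentBetti_eq_sub [Finite V] (n : ℕ) :
    (persistentBetti F n K L : ℤ) = Module.finrank F (simplicialCycles F n K) -
      Module.finrank F (simplicialCycles F n K ⊓ simplicialBoundaries F n L :
        Submodule F (Finset V →₀ F)) := by
  have h := finrank_map_add_finrank_inf_ker (simplicialCycles F n K)
    (simplicialBoundaries F n L).mkQ
  rw [Submodule.ker_mkQ] at h
  rw [persistentBetti, ← h, Nat.cast_add, add_sub_cancel_right]

/-- The `1`-skeleton of a simplicial complex as a graph on the whole vertex type. -/
def edgeGraph (K : PreAbstractSimplicialComplex V) : SimpleGraph V where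
  Adj u v := u ≠ v ∧ ∃ s ∈ K.faces, u ∈ s ∧ v ∈ s
  symm := ⟨fun _ _ h => ⟨h.1.symm, h.2.imp fun _ hs => ⟨hs.1, hs.2.symm⟩⟩⟩
  loopless := ⟨fun _ h => h.1 rfl⟩

/-- The rank of the boundary operator from edges to points, over `ℤ/2`. -/
noncomputable def boundaryRank (K : PreAbstractSimplicialComplex V) : ℕ :=
  Module.finrank (ZMod 2) (simplicialBoundaries (ZMod 2) 0 K)

/-- The dimension of the space of `1`-cycles over `ℤ/2`. -/
noncomputable def cycleRank (K : PreAbstractSimplicialComplex V) : ℕ :=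
  Module.finrank (ZMod 2) (simplicialCycles (ZMod 2) 1 K)

theorem pair_mem_faces_iff [DecidableEq V] {u v : V} (h : u ≠ v) :
    {u, v} ∈ K.faces ↔ (edgeGraph K).Adj u v := by
  constructor
  · exact fun hs => ⟨h, _, hs, by simp, by simp⟩
  · rintro ⟨-, s, hs, hu, hv⟩
    exact (K.isRelLowerSet_faces hs).2 (Finset.insert_subset hu (Finset.singleton_subset_iff.2 hv))
      (Finset.insert_nonempty _ _)

theorem simplicialBoundary_pair [DecidableEq V] {u v : V} (h : u ≠ v) :
    simplicialBoundary (ZMod 2) V (Finsupp.single {u, v} 1) =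
      Finsupp.single {u} 1 - Finsupp.single {v} 1 := by
  have hu : ({u, v} : Finset V).erase u = {v} := by grind
  have hv : ({u, v} : Finset V).erase v = {u} := by grind
  have hsum := Finset.sum_pair
    (f := fun w => Finsupp.single (({u, v} : Finset V).erase w) (1 : ZMod 2)) h
  rw [hu, hv, add_comm, ← ZModModule.sub_eq_add] at hsum
  rw [simplicialBoundary, Finsupp.linearCombination_single, one_smul, ← hsum]
  congr!

theorem simplicialBoundaries_zero_eq_span :
    simplicialBoundaries (ZMod 2) 0 K = Submodule.span (ZMod 2)
      {c | ∃ u v, (edgeGraph K).Adj u v ∧ c = Finsupp.single {u} 1 - Finsupp.single {v} 1} := by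
  classical
  rw [simplicialBoundaries, simplicialChains, Finsupp.supported_eq_span_single, Submodule.map_span]
  congr 1
  ext c
  constructor
  · rintro ⟨_, ⟨s, hs, rfl⟩, rfl⟩
    obtain ⟨u, v, huv, rfl⟩ := Finset.card_eq_two.1 hs.2
    exact ⟨u, v, (pair_mem_faces_iff huv).1 hs.1, simplicialBoundary_pair huv⟩
  · rintro ⟨u, v, h, rfl⟩
    exact ⟨_, ⟨{u, v}, ⟨(pair_mem_faces_iff h.ne).2 h, Finset.card_pair h.ne⟩, rfl⟩,
      simplicialBoundary_pair h.ne⟩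

theorem single_sub_single_mem_simplicialBoundaries {u v : V} (h : (edgeGraph K).Reachable u v) :
    (Finsupp.single {u} 1 - Finsupp.single {v} 1 : Finset V →₀ ZMod 2) ∈
      simplicialBoundaries (ZMod 2) 0 K := by
  obtain ⟨p⟩ := h
  induction p with
  | nil => rw [sub_self]; exact Submodule.zero_mem _
  | cons hadj _ ih =>
    rw [← sub_add_sub_cancel]
    refine Submodule.add_mem _ ?_ ih
    rw [simplicialBoundaries_zero_eq_span]
    exact Submodule.subset_span ⟨_, _, hadj, rfl⟩

theorem simplicialBoundaries_zero_le :
    simplicialBoundaries (ZMod 2) 0 K ≤ Finsupp.supported _ _ {s : Finset V | s.card = 1} := by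
  rw [simplicialBoundaries_zero_eq_span, Submodule.span_le]
  rintro _ ⟨u, v, -, rfl⟩
  exact Submodule.sub_mem _ (Finsupp.single_mem_supported _ _ (Finset.card_singleton u))
    (Finsupp.single_mem_supported _ _ (Finset.card_singleton v))

/-- The map from chains to functions on the connected components which sums coefficients of points.
Its kernel on `0`-chains is the space of boundaries. -/
noncomputable def componentSum (K : PreAbstractSimplicialComplex V) :
    (Finset V →₀ ZMod 2) →ₗ[ZMod 2] ((edgeGraph K).ConnectedComponent →₀ ZMod 2) :=
  Finsupp.linearCombination (ZMod 2)
    fun s => ∑ v ∈ s, Finsupp.single ((edgeGraph K).connectedComponentMk v) 1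

theorem componentSum_single (v : V) : componentSum K (Finsupp.single {v} 1) =
    Finsupp.single ((edgeGraph K).connectedComponentMk v) 1 := by
  rw [componentSum, Finsupp.linearCombination_single, one_smul, Finset.sum_singleton]

theorem supported_inf_ker_componentSum :
    Finsupp.supported (ZMod 2) (ZMod 2) {s : Finset V | s.card = 1} ⊓
      LinearMap.ker (componentSum K) = simplicialBoundaries (ZMod 2) 0 K := by
  apply le_antisymm
  · let lift : ((edgeGraph K).ConnectedComponent →₀ ZMod 2) →ₗ[ZMod 2] (Finset V →₀ ZMod 2) :=
      Finsupp.linearCombination (ZMod 2) fun c => Finsupp.single {c.out} 1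
    have hsub : Finsupp.supported (ZMod 2) (ZMod 2) {s : Finset V | s.card = 1} ≤
        (simplicialBoundaries (ZMod 2) 0 K).comap (LinearMap.id - lift ∘ₗ componentSum K) := by
      rw [Finsupp.supported_eq_span_single, Submodule.span_le]
      rintro _ ⟨s, hs, rfl⟩
      obtain ⟨v, rfl⟩ := Finset.card_eq_one.1 hs
      rw [SetLike.mem_coe, Submodule.mem_comap, LinearMap.sub_apply, LinearMap.id_apply,
        LinearMap.comp_apply, componentSum_single, Finsupp.linearCombination_single, one_smul]
      exact single_sub_single_mem_simplicialBoundaries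
        (SimpleGraph.ConnectedComponent.exact (Quot.out_eq _).symm)
    rintro c ⟨hc, hker⟩
    have := hsub hc
    rwa [Submodule.mem_comap, LinearMap.sub_apply, LinearMap.comp_apply, LinearMap.mem_ker.1 hker,
      map_zero, sub_zero] at this
  · refine le_inf simplicialBoundaries_zero_le ?_
    rw [simplicialBoundaries_zero_eq_span, Submodule.span_le]
    rintro _ ⟨u, v, h, rfl⟩
    rw [SetLike.mem_coe, LinearMap.mem_ker, map_sub, componentSum_single, componentSum_single,
      SimpleGraph.ConnectedComponent.eq.2 h.reachable, sub_self]

theorem map_componentSum_supported :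
    (Finsupp.supported (ZMod 2) (ZMod 2) {s : Finset V | s.card = 1}).map (componentSum K) = ⊤ := by
  rw [eq_top_iff, ← Finsupp.supported_univ, Finsupp.supported_eq_span_single, Submodule.span_le]
  rintro _ ⟨c, -, rfl⟩
  induction c using SimpleGraph.ConnectedComponent.ind with
  | h v =>
    exact ⟨_, Finsupp.single_mem_supported _ _ (Finset.card_singleton v), componentSum_single v⟩

variable [Finite V]

theorem finrank_supported_singletons :
    Module.finrank F (Finsupp.supported F F {s : Finset V | s.card = 1}) = Nat.card V := by
  have hrange : {s : Finset V | s.card = 1} = Set.range fun v : V => {v} := by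
    ext s
    simp only [Set.mem_ofPred_eq, Finset.card_eq_one, Set.mem_range, eq_comm]
  rw [finrank_supported, hrange, Set.ncard_range_of_injective Finset.singleton_injective]

theorem card_connectedComponent_add_boundaryRank :
    Nat.card (edgeGraph K).ConnectedComponent + boundaryRank K = Nat.card V := by
  classical
  cases nonempty_fintype V
  have h := finrank_map_add_finrank_inf_ker
    (Finsupp.supported (ZMod 2) (ZMod 2) {s : Finset V | s.card = 1}) (componentSum K)
  rwa [map_componentSum_supported, supported_inf_ker_componentSum, finrank_top,
    finrank_supported_singletons, Module.finrank_finsupp_self, ← Nat.card_eq_fintype_card] at h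

theorem boundaryRank_mono (h : K ≤ L) : boundaryRank K ≤ boundaryRank L :=
  Submodule.finrank_mono (Submodule.map_mono (simplicialChains_mono _ h))

theorem cycleRank_mono (h : K ≤ L) : cycleRank K ≤ cycleRank L := by
  refine Submodule.finrank_mono ?_
  rw [simplicialCycles, simplicialCycles, if_neg one_ne_zero, if_neg one_ne_zero]
  exact inf_le_inf_right _ (simplicialChains_mono _ h)

theorem ncard_edgeSet_edgeGraph :
    (edgeGraph K).edgeSet.ncard = boundaryRank K + cycleRank K := by
  classical
  rw [boundaryRank, cycleRank, simplicialCycles, if_neg one_ne_zero, simplicialBoundaries,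
    finrank_map_add_finrank_inf_ker, simplicialChains, finrank_supported]
  refine Set.ncard_congr (fun e _ => e.toFinset) (fun e he => ?_) (fun e f _ _ h => ?_)
    fun s hs => ?_
  · induction e with
    | h u v =>
      rw [Sym2.toFinset_mk_eq]
      exact ⟨(pair_mem_faces_iff ((SimpleGraph.mem_edgeSet _).1 he).ne).2 he,
        Finset.card_pair ((SimpleGraph.mem_edgeSet _).1 he).ne⟩
  · exact Sym2.ext fun v => by rw [← Sym2.mem_toFinset, h, Sym2.mem_toFinset]
  · obtain ⟨u, v, huv, rfl⟩ := Finset.card_eq_two.1 hs.2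
    exact ⟨s(u, v), (pair_mem_faces_iff huv).1 hs.1, Sym2.toFinset_mk_eq⟩

theorem persistentBetti_zero (hK : ∀ v, {v} ∈ K.faces) :
    (persistentBetti (ZMod 2) 0 K L : ℤ) = Nat.card V - boundaryRank L := by
  have hcycles : simplicialCycles (ZMod 2) 0 K =
      Finsupp.supported (ZMod 2) (ZMod 2) {s : Finset V | s.card = 1} := by
    rw [simplicialCycles, if_pos rfl, simplicialChains]
    congr 1
    ext s
    refine and_iff_right_of_imp fun hs => ?_
    obtain ⟨v, rfl⟩ := Finset.card_eq_one.1 hs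
    exact hK v
  rw [persistentBetti_eq_sub, hcycles, inf_eq_right.2 simplicialBoundaries_zero_le,
    finrank_supported_singletons, boundaryRank]

theorem persistentBetti_one (hL : ∀ s ∈ L.faces, s.card ≤ 2) :
    persistentBetti (ZMod 2) 1 K L = cycleRank K := by
  have hbot : simplicialBoundaries (ZMod 2) 1 L = ⊥ := by
    rw [simplicialBoundaries, simplicialChains_eq_bot fun s hs => by grind, Submodule.map_bot]
  zify
  rw [persistentBetti_eq_sub, hbot, inf_bot_eq, finrank_bot, Nat.cast_zero, sub_zero, cycleRank]

end Homology
/-! ### Persistence diagrams of one-dimensional Vietoris-Rips filtrations -/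

theorem sum_filter_le_sub_filter_lt {α A : Type*} [LinearOrder α] [AddCommGroup A]
    (f : Finset α → A) (S : Finset α) :
    ∑ d ∈ S, (f (S.filter (· ≤ d)) - f (S.filter (· < d))) = f S - f ∅ := by
  induction S using Finset.induction_on_max with
  | empty => rw [Finset.sum_empty, sub_self]
  | insert a S hlt ih =>
    have haS : a ∉ S := fun h => lt_irrefl a (hlt a h)
    have htop : (insert a S).filter (· ≤ a) = insert a S :=
      Finset.filter_true_of_mem fun d hd => by grind
    have hbelow : (insert a S).filter (· < a) = S := by
      ext d
      have := hlt d
      grind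
    rw [Finset.sum_insert haS, htop, hbelow, ← sub_add_sub_cancel _ (f S) (f ∅), ← ih]
    congr 1
    refine Finset.sum_congr rfl fun d hd => ?_
    rw [Finset.filter_insert, Finset.filter_insert, if_neg (hlt d hd).not_ge,
      if_neg (hlt d hd).not_gt]

section Persistence

variable {V : Type} {M : V → V → ℝ} {I J : Set ℝ} {r : ℝ}

/-- The one-dimensional complexes of the filtration whose persistence diagrams are taken. -/
abbrev vrSkeleton (M : V → V → ℝ) (I : Set ℝ) : PreAbstractSimplicialComplex V :=
  skeleton 1 (vrComplex M I)

theorem vrSkeleton_mono (h : I ⊆ J) : vrSkeleton M I ≤ vrSkeleton M J :=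
  fun _ hs => ⟨⟨hs.1.1, fun u hu v hv => h (hs.1.2 u hu v hv)⟩, hs.2⟩

theorem vrSkeleton_congr (h : ∀ u v, M u v ∈ I ↔ M u v ∈ J) : vrSkeleton M I = vrSkeleton M J :=
  le_antisymm (fun _ hs => ⟨⟨hs.1.1, fun u hu v hv => (h u v).1 (hs.1.2 u hu v hv)⟩, hs.2⟩)
    fun _ hs => ⟨⟨hs.1.1, fun u hu v hv => (h u v).2 (hs.1.2 u hu v hv)⟩, hs.2⟩

theorem singleton_mem_vrSkeleton (hM : ∀ u, M u u = 0) (hI : 0 ∈ I) (v : V) :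
    {v} ∈ (vrSkeleton M I).faces := by
  refine ⟨⟨Finset.singleton_nonempty v, fun u hu w hw => ?_⟩, by simp⟩
  rwa [Finset.mem_singleton.1 hu, Finset.mem_singleton.1 hw, hM]

theorem edgeGraph_vrSkeleton_adj (hM : ∀ u, M u u = 0) (hs : ∀ u v, M u v = M v u) (hI : 0 ∈ I)
    {u v : V} : (edgeGraph (vrSkeleton M I)).Adj u v ↔ u ≠ v ∧ M u v ∈ I := by
  classical
  refine ⟨fun h => ⟨h.1, ?_⟩, fun h => ?_⟩
  · obtain ⟨-, s, hs, hu, hv⟩ := h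
    exact hs.1.2 u hu v hv
  · rw [← pair_mem_faces_iff h.1]
    refine ⟨⟨Finset.insert_nonempty _ _, ?_⟩, (Finset.card_pair h.1).le⟩
    simp only [Finset.mem_insert, Finset.mem_singleton, forall_eq_or_imp, forall_eq, hM, hs v u]
    exact ⟨⟨hI, h.2⟩, h.2, hI⟩

theorem vrBetti_zero [Finite V] (hM : ∀ u, M u u = 0) (hI : 0 ∈ I) :
    vrBetti 0 M I J = Nat.card V - boundaryRank (vrSkeleton M J) :=
  persistentBetti_zero (singleton_mem_vrSkeleton hM hI)

theorem vrBetti_one [Finite V] : vrBetti 1 M I J = cycleRank (vrSkeleton M I) :=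
  congrArg _ (persistentBetti_one fun s (hs : s ∈ (vrSkeleton M J).faces) => hs.2)

theorem vrBetti_zero_of_notMem (hM : ∀ u, M u u = 0) (hI : 0 ∉ I) : vrBetti 0 M I J = 0 := by
  have hfaces : ∀ s ∈ (vrSkeleton M I).faces, s.card ≠ 0 + 1 := fun s hs hcard => by
    obtain ⟨v, rfl⟩ := Finset.card_eq_one.1 hcard
    exact hI (hM v ▸ hs.1.2 v (Finset.mem_singleton_self v) v (Finset.mem_singleton_self v))
  rw [vrBetti, persistentBetti, simplicialCycles, if_pos rfl, simplicialChains_eq_bot hfaces,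
    Submodule.map_bot, finrank_bot, Nat.cast_zero]

theorem boundaryRank_Iic_zero (hpos : ∀ u v, u ≠ v → 0 < M u v) :
    boundaryRank (vrSkeleton M (Set.Iic 0)) = 0 := by
  have hfaces : ∀ s ∈ (vrSkeleton M (Set.Iic 0)).faces, s.card ≠ 0 + 1 + 1 := fun s hs hcard => by
    obtain ⟨u, hu, v, hv, huv⟩ := Finset.one_lt_card.1 (by omega : 1 < s.card)
    exact (hpos u v huv).not_ge (hs.1.2 u hu v hv)
  rw [boundaryRank, simplicialBoundaries, simplicialChains_eq_bot hfaces, Submodule.map_bot,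
    finrank_bot]

section Multiplicity

variable [Finite V]

theorem diagramMultiplicity_zero_zero (hM : ∀ u, M u u = 0) (d : ℝ) :
    (diagramMultiplicity 0 M 0 d : ℤ) =
      boundaryRank (vrSkeleton M (Set.Iic d)) - boundaryRank (vrSkeleton M (Set.Iio d)) := by
  have hle := boundaryRank_mono (vrSkeleton_mono (M := M) (Set.Iio_subset_Iic_self (a := d)))
  rw [diagramMultiplicity, vrBetti_zero hM Set.self_mem_Iic, vrBetti_zero hM Set.self_mem_Iic,
    vrBetti_zero_of_notMem hM Set.self_notMem_Iio, vrBetti_zero_of_notMem hM Set.self_notMem_Iio]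
  omega

theorem diagramMultiplicity_zero_of_pos (hM : ∀ u, M u u = 0) {b : ℝ} (hb : 0 < b) (d : ℝ) :
    diagramMultiplicity 0 M b d = 0 := by
  rw [diagramMultiplicity, vrBetti_zero hM (Set.mem_Iic.2 hb.le),
    vrBetti_zero hM (Set.mem_Iic.2 hb.le), vrBetti_zero hM (Set.mem_Iio.2 hb),
    vrBetti_zero hM (Set.mem_Iio.2 hb), sub_self, sub_self, sub_self, Int.toNat_zero]

theorem essentialMultiplicity_zero_zero (hM : ∀ u, M u u = 0) (r : ℝ) :
    essentialMultiplicity 0 M r 0 =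
      Nat.card (edgeGraph (vrSkeleton M (Set.Iic r))).ConnectedComponent := by
  have hcard := card_connectedComponent_add_boundaryRank (K := vrSkeleton M (Set.Iic r))
  rw [essentialMultiplicity, vrBetti_zero hM Set.self_mem_Iic,
    vrBetti_zero_of_notMem hM Set.self_notMem_Iio]
  omega

theorem essentialMultiplicity_zero_of_pos (hM : ∀ u, M u u = 0) {b : ℝ} (hb : 0 < b) (r : ℝ) :
    essentialMultiplicity 0 M r b = 0 := by
  rw [essentialMultiplicity, vrBetti_zero hM (Set.mem_Iic.2 hb.le),
    vrBetti_zero hM (Set.mem_Iio.2 hb), sub_self, Int.toNat_zero]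

theorem essentialMultiplicity_one (r b : ℝ) : (essentialMultiplicity 1 M r b : ℤ) =
    cycleRank (vrSkeleton M (Set.Iic b)) - cycleRank (vrSkeleton M (Set.Iio b)) := by
  have hle := cycleRank_mono (vrSkeleton_mono (M := M) (Set.Iio_subset_Iic_self (a := b)))
  rw [essentialMultiplicity, vrBetti_one, vrBetti_one]
  omega

end Multiplicity

variable [Fintype V]

theorem mem_criticalScales {t : ℝ} : t ∈ criticalScales M r ↔ (∃ u v, M u v = t) ∧ t ≤ r := by
  simp [criticalScales]

theorem count_persistenceDiagram_coe (n : ℕ) {b d : ℝ} (hb : b ∈ criticalScales M r)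
    (hd : d ∈ criticalScales M r) (hbd : b < d) :
    (persistenceDiagram n M r).count (b, (d : WithTop ℝ)) = diagramMultiplicity n M b d := by
  classical
  rw [persistenceDiagram, Multiset.count_add, Multiset.count_sum', Multiset.count_sum']
  simp only [Multiset.count_sum', Multiset.count_replicate, Prod.mk.injEq, WithTop.coe_inj,
    WithTop.top_ne_coe, and_false, if_false, Finset.sum_const_zero, add_zero]
  rw [Finset.sum_eq_single_of_mem b hb fun b' _ hb' => Finset.sum_eq_zero fun d' _ => by simp [hb']]
  simp [hd, hbd]

theorem count_persistenceDiagram_top (n : ℕ) (b : ℝ) :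
    (persistenceDiagram n M r).count (b, ⊤) =
      if b ∈ criticalScales M r then essentialMultiplicity n M r b else 0 := by
  classical
  rw [persistenceDiagram, Multiset.count_add, Multiset.count_sum', Multiset.count_sum']
  simp [Multiset.count_sum', Multiset.count_replicate]

theorem mem_criticalScales_of_mem_persistenceDiagram {n : ℕ} {b d : ℝ}
    (h : (b, (d : WithTop ℝ)) ∈ persistenceDiagram n M r) : d ∈ criticalScales M r := by
  rw [persistenceDiagram, Multiset.mem_add, Multiset.mem_sum, Multiset.mem_sum] at h
  obtain ⟨b', -, h⟩ | ⟨b', -, h⟩ := h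
  · obtain ⟨d', hd', h⟩ := Multiset.mem_sum.1 h
    obtain ⟨-, h⟩ := Prod.mk.inj (Multiset.eq_of_mem_replicate h)
    rw [WithTop.coe_inj.1 h]
    exact (Finset.mem_filter.1 hd').1
  · cases (Prod.mk.inj (Multiset.eq_of_mem_replicate h)).2

theorem two_mul_boundaryRank_add_cycleRank [DecidableEq V] [DecidablePred (· ∈ I)]
    (hM : ∀ u, M u u = 0) (hs : ∀ u v, M u v = M v u) (hI : 0 ∈ I) :
    2 * (boundaryRank (vrSkeleton M I) + cycleRank (vrSkeleton M I)) =
      (Finset.univ.filter fun p : V × V => p.1 ≠ p.2 ∧ M p.1 p.2 ∈ I).card := by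
  classical
  rw [← ncard_edgeSet_edgeGraph, ← SimpleGraph.coe_edgeFinset, Set.ncard_coe_finset,
    SimpleGraph.two_mul_card_edgeFinset]
  simp only [edgeGraph_vrSkeleton_adj hM hs hI]

-- An edge of value `d` either merges two components, which gives a point `(0, d)` of the first
-- diagram, or creates a cycle that is never filled, which gives a point `(d, ⊤)` of the second.
theorem two_mul_count_persistenceDiagram [DecidableEq V] (hM : ∀ u, M u u = 0)
    (hs : ∀ u v, M u v = M v u) {d : ℝ} (hd : 0 < d) (hdr : d ≤ r) :
    2 * ((persistenceDiagram 0 M r).count (0, (d : WithTop ℝ)) +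
        (persistenceDiagram 1 M r).count (d, ⊤)) =
      (Finset.univ.filter fun p : V × V => p.1 ≠ p.2 ∧ M p.1 p.2 = d).card := by
  by_cases hc : d ∈ criticalScales M r
  · obtain ⟨⟨u, -⟩, -⟩ := mem_criticalScales.1 hc
    have h0 : 0 ∈ criticalScales M r := mem_criticalScales.2 ⟨⟨u, u, hM u⟩, hd.le.trans hdr⟩
    have hsplit : (Finset.univ.filter fun p : V × V => p.1 ≠ p.2 ∧ M p.1 p.2 ∈ Set.Iic d).card =
        (Finset.univ.filter fun p : V × V => p.1 ≠ p.2 ∧ M p.1 p.2 ∈ Set.Iio d).card +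
          (Finset.univ.filter fun p : V × V => p.1 ≠ p.2 ∧ M p.1 p.2 = d).card := by
      rw [← Finset.card_union_of_disjoint (by grind [Finset.disjoint_left]), ← Finset.filter_or]
      simp only [← and_or_left, Set.mem_Iic, Set.mem_Iio, le_iff_lt_or_eq]
    rw [count_persistenceDiagram_coe _ h0 hc hd, count_persistenceDiagram_top, if_pos hc]
    have hmerge := diagramMultiplicity_zero_zero hM d
    have hcycle := essentialMultiplicity_one (M := M) r d
    rw [← two_mul_boundaryRank_add_cycleRank hM hs (Set.mem_Iic.2 hd.le),
      ← two_mul_boundaryRank_add_cycleRank hM hs (Set.mem_Iio.2 hd)] at hsplit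
    omega
  · have hempty : (Finset.univ.filter fun p : V × V => p.1 ≠ p.2 ∧ M p.1 p.2 = d) = ∅ :=
      Finset.filter_false_of_mem fun p _ hp => hc (mem_criticalScales.2 ⟨⟨p.1, p.2, hp.2⟩, hdr⟩)
    rw [hempty, Finset.card_empty, count_persistenceDiagram_top, if_neg hc,
      Multiset.count_eq_zero_of_notMem (mt mem_criticalScales_of_mem_persistenceDiagram hc)]

theorem sum_criticalScales_boundaryRank (hM : ∀ u, M u u = 0) (hpos : ∀ u v, u ≠ v → 0 < M u v)
    (r : ℝ) :
    ∑ d ∈ (criticalScales M r).filter (0 < ·),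
      ((boundaryRank (vrSkeleton M (Set.Iic d)) : ℤ) - boundaryRank (vrSkeleton M (Set.Iio d))) =
        boundaryRank (vrSkeleton M (Set.Iic r)) := by
  have hmono : ∀ {I J : Set ℝ}, I ⊆ J → boundaryRank (vrSkeleton M I) ≤
      boundaryRank (vrSkeleton M J) := fun h => boundaryRank_mono (vrSkeleton_mono h)
  have hzero : boundaryRank (vrSkeleton M (Set.Iic 0)) = 0 := boundaryRank_Iic_zero hpos
  have hcrit : ∀ {d} (u v), d ≤ r → M u v ≤ d → M u v ∈ criticalScales M r :=
    fun u v hd h => mem_criticalScales.2 ⟨⟨u, v, rfl⟩, h.trans hd⟩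
  have hnonneg : ∀ d ∈ criticalScales M r, 0 ≤ d := fun d hd => by
    obtain ⟨⟨u, v, rfl⟩, -⟩ := mem_criticalScales.1 hd
    obtain rfl | h := eq_or_ne u v
    exacts [(hM u).ge, (hpos u v h).le]
  rw [Finset.sum_filter_of_ne fun d hd hne => (hnonneg d hd).lt_of_ne' fun h0 => hne ?_]
  · have htel := sum_filter_le_sub_filter_lt
      (fun S : Finset ℝ => (boundaryRank (vrSkeleton M (S : Set ℝ)) : ℤ)) (criticalScales M r)
    have hempty : boundaryRank (vrSkeleton M ((∅ : Finset ℝ) : Set ℝ)) = 0 :=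
      Nat.eq_zero_of_le_zero (hzero ▸ hmono (by simp))
    rw [hempty, Nat.cast_zero, sub_zero,
      vrSkeleton_congr (J := Set.Iic r) fun u v => by simp [mem_criticalScales]] at htel
    rw [← htel]
    refine Finset.sum_congr rfl fun d hd => ?_
    have hdr := (mem_criticalScales.1 hd).2
    congr 3 <;> refine vrSkeleton_congr fun u v => ?_
    · simpa using hcrit u v hdr
    · simpa using fun h : M u v < d => hcrit u v hdr h.le
  · subst h0
    have hle := hzero ▸ hmono (Set.Iio_subset_Iic_self (a := (0 : ℝ)))
    rw [hzero, Nat.eq_zero_of_le_zero hle, sub_self]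

theorem card_persistenceDiagram_zero (hM : ∀ u, M u u = 0) (hpos : ∀ u v, u ≠ v → 0 < M u v)
    (hr : 0 ≤ r) : (persistenceDiagram 0 M r).card = Fintype.card V := by
  have hpos_of_ne : ∀ b ∈ criticalScales M r, b ≠ 0 → 0 < b := fun b hb hb0 => by
    obtain ⟨⟨u, v, rfl⟩, -⟩ := mem_criticalScales.1 hb
    exact hpos u v fun h => hb0 (h ▸ hM u)
  rw [persistenceDiagram, Multiset.card_add, Multiset.card_sum, Multiset.card_sum]
  simp only [Multiset.card_sum, Multiset.card_replicate]
  rcases isEmpty_or_nonempty V with hV | ⟨⟨v⟩⟩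
  · have hempty : criticalScales M r = ∅ := Finset.eq_empty_of_forall_notMem fun t ht =>
      hV.elim (mem_criticalScales.1 ht).1.choose
    rw [hempty, Finset.sum_empty, Finset.sum_empty, Fintype.card_eq_zero, add_zero]
  · have h0 : 0 ∈ criticalScales M r := mem_criticalScales.2 ⟨⟨v, v, hM v⟩, hr⟩
    rw [Finset.sum_eq_single_of_mem 0 h0 fun b hb hb0 => Finset.sum_eq_zero fun d _ =>
        diagramMultiplicity_zero_of_pos hM (hpos_of_ne b hb hb0) d,
      Finset.sum_eq_single_of_mem 0 h0 fun b hb hb0 =>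
        essentialMultiplicity_zero_of_pos hM (hpos_of_ne b hb hb0) r,
      essentialMultiplicity_zero_zero hM, ← Nat.card_eq_fintype_card,
      ← card_connectedComponent_add_boundaryRank (K := vrSkeleton M (Set.Iic r)), add_comm]
    zify
    simp only [diagramMultiplicity_zero_zero hM]
    rw [sum_criticalScales_boundaryRank hM hpos]

theorem count_zero_top_persistenceDiagram [Nonempty V] (hM : ∀ u, M u u = 0) (hr : 0 ≤ r) :
    (persistenceDiagram 0 M r).count (0, ⊤) =
      Nat.card (edgeGraph (vrSkeleton M (Set.Iic r))).ConnectedComponent := by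
  obtain ⟨v⟩ := ‹Nonempty V›
  rw [count_persistenceDiagram_top, if_pos (mem_criticalScales.2 ⟨⟨v, v, hM v⟩, hr⟩),
    essentialMultiplicity_zero_zero hM]

end Persistence

/-! ### Weights of LGVR that recover the graph -/

theorem exists_radius_of_fixedPoints {f : ℝ → ℝ} (hf : Continuous f) {S : Set ℝ} (hS : S.Finite)
    (hfix : ∀ k ∈ S, f k = k) {η : ℝ} (hη : 0 < η) :
    ∃ r > 0, ∀ k ∈ S, ∀ z, |z - k| < r → |f z - k| < η := by
  obtain ⟨r, hr, H⟩ := Metric.mem_uniformity_dist.1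
    (hS.isCompact.uniformContinuousAt_of_continuousAt f (fun _ _ => hf.continuousAt)
      (Metric.dist_mem_uniformity hη))
  refine ⟨r, hr, fun k hk z hz => ?_⟩
  have := @H k z (by rwa [dist_comm, Real.dist_eq]) hk
  rwa [Set.mem_ofPred_eq, dist_comm, Real.dist_eq, hfix k hk] at this

theorem IsAnalyticSigmoidal.exists_gate {σ : ℝ → ℝ} (hσ : IsAnalyticSigmoidal σ) :
    ∃ f : ℝ → ℝ, Continuous f ∧ (∀ k ∈ ({0, 1} : Set ℝ), f k = k) ∧
      ∀ α κ γ, IsSingleUnit σ fun x : Fin 1 → ℝ => α * f (κ * x 0) + γ := by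
  obtain ⟨p, q, hpq⟩ := hσ.exists_ne
  have hne : σ q - σ p ≠ 0 := sub_ne_zero.2 hpq.symm
  have hc := hσ.continuous
  -- The affine renormalisation of `σ` which fixes `0` and `1`.
  refine ⟨fun z => (σ ((q - p) * z + p) - σ p) / (σ q - σ p), by fun_prop, ?_, fun α κ γ =>
    ⟨α / (σ q - σ p), fun _ => (q - p) * κ, p, γ - α * σ p / (σ q - σ p), fun x => ?_⟩⟩
  · rintro k (rfl | rfl)
    · simp
    · simp [hne]
  · simp only [dotProduct, Fin.sum_univ_one, mul_assoc]
    ring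

theorem IsAnalyticSigmoidal.exists_mlp_near_affine {σ : ℝ → ℝ} (hσ : IsAnalyticSigmoidal σ)
    (α γ : ℝ) {ρ : ℝ} (hρ : 0 < ρ) :
    ∃ r > 0, ∀ (κ : ℝ) {S : Set (Fin 1 → ℝ)}, S.Countable →
      ∃ g : MLP 1 1, SumInjOn (g.eval σ) S ∧ ∀ z, ∀ k ∈ ({0, 1} : Set ℝ), |κ * z 0 - k| < r →
        |g.eval σ z 0 - (α * k + γ)| < ρ := by
  obtain ⟨f, hf, hfix, hunit⟩ := hσ.exists_gate
  obtain ⟨r, hr, hfr⟩ := exists_radius_of_fixedPoints hf (Set.toFinite _) hfix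
    (η := ρ / (2 * (|α| + 1))) (by positivity)
  refine ⟨r, hr, fun κ S hS => ?_⟩
  obtain ⟨g, hgf, hg⟩ := hσ.exists_mlp_sumInjOn_near hS (hunit α κ γ) (half_pos hρ)
  refine ⟨g, hg, fun z k hk hz => ?_⟩
  have hscale : |α * (f (κ * z 0) - k)| ≤ ρ / 2 := by
    calc |α * (f (κ * z 0) - k)| = |α| * |f (κ * z 0) - k| := abs_mul _ _
      _ ≤ (|α| + 1) * (ρ / (2 * (|α| + 1))) := by
          gcongr
          exacts [by linarith, (hfr k hk _ hz).le]
      _ = ρ / 2 := by field_simp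
  calc |g.eval σ z 0 - (α * k + γ)|
      = |(g.eval σ z 0 - (α * f (κ * z 0) + γ)) + α * (f (κ * z 0) - k)| := by ring_nf
    _ ≤ |g.eval σ z 0 - (α * f (κ * z 0) + γ)| + |α * (f (κ * z 0) - k)| := abs_add_le _ _
    _ < ρ := by linarith [hgf z]

section LineGraphs

variable {I : Type} {V : I → Type} [Countable I] [∀ i, Fintype (V i)]

-- A large `ε` makes the contribution of the neighbours negligible relative to that of the node.
theorem exists_eps_ginAggregate_near (G : ∀ i, SimpleGraph (V i)) {a : ℕ}
    (x : ∀ i, V i → (Fin a → ℝ)) {n : ℕ} (hn : ∀ i, Fintype.card (V i) ≤ n) {B : ℝ}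
    (hB : ∀ i v k, |x i v k| ≤ B) {r : ℝ} (hr : 0 < r) :
    ∃ ε, (∀ i v k, |(1 + ε)⁻¹ * ginAggregate (G i) ε (x i) v k - x i v k| < r) ∧
      ∀ {i j u v}, ginAggregate (G i) ε (x i) u = ginAggregate (G j) ε (x j) v →
        x i u = x j v := by
  obtain ⟨ε, hlt, hinj⟩ := exists_eps_ginAggregate G x (n * |B| / r)
  have hpos : 0 < 1 + ε := lt_of_le_of_lt (by positivity) hlt
  refine ⟨ε, fun i v k => ?_, fun h => (hinj h).1⟩
  have hsum : |((nbrs (G i) v).map fun u => x i u k).sum| ≤ n * |B| := by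
    calc |((nbrs (G i) v).map fun u => x i u k).sum|
        ≤ (((nbrs (G i) v).map fun u => x i u k).map fun y => |y|).sum :=
          Multiset.abs_sum_le_sum_abs
      _ ≤ (((nbrs (G i) v).map fun u => x i u k).map fun y => |y|).card • |B| := by
          refine Multiset.sum_le_card_nsmul _ _ fun y hy => ?_
          simp only [Multiset.mem_map, exists_exists_and_eq_and] at hy
          obtain ⟨u, -, rfl⟩ := hy
          exact (hB i u k).trans (le_abs_self B)
      _ ≤ n * |B| := by
          rw [Multiset.card_map, Multiset.card_map, nsmul_eq_mul]
          gcongr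
          exact (Finset.card_le_univ _).trans (hn i)
  have hdiff : (1 + ε)⁻¹ * ginAggregate (G i) ε (x i) v k - x i v k =
      ((nbrs (G i) v).map fun u => x i u k).sum / (1 + ε) := by
    rw [ginAggregate_eq, Pi.add_apply, sum_map_apply, Pi.smul_apply, smul_eq_mul]
    field_simp
    ring
  rw [hdiff, abs_div, abs_of_pos hpos, div_lt_iff₀ hpos]
  exact hsum.trans_lt (by rwa [div_lt_iff₀ hr, mul_comm (1 + ε)] at hlt)

variable {σ : ℝ → ℝ} (hσ : IsAnalyticSigmoidal σ)
include hσ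

theorem IsAnalyticSigmoidal.exists_gin_near_one (G : ∀ i, SimpleGraph (V i)) {a : ℕ}
    (x : ∀ i, V i → (Fin a → ℝ)) {η : ℝ} (hη : 0 < η) :
    ∃ P : GIN a 1, (∀ i v, |P.eval σ (G i) (x i) v 0 - 1| < η) ∧
      ∀ {i j u v}, P.eval σ (G i) (x i) u = P.eval σ (G j) (x j) v → x i u = x j v := by
  obtain ⟨g, hg⟩ := hσ.exists_mlp_sumInjOn (countable_jointRange x)
  obtain ⟨ε, -, hε⟩ := exists_eps_ginAggregate G (fun i v => g.eval σ (x i v)) 0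
  obtain ⟨g', hg'near, hg'⟩ := hσ.exists_mlp_sumInjOn_near
    (countable_jointRange fun i => ginAggregate (G i) ε fun v => g.eval σ (x i v))
    (isSingleUnit_const σ 1) hη
  refine ⟨⟨1, g, .one ε g'⟩, fun i v => hg'near _, fun {i j u v} h => ?_⟩
  exact hg.injOn (mem_jointRange x i u) (mem_jointRange x j v)
    (hε (hg'.injOn (mem_jointRange _ i u) (mem_jointRange _ j v) h)).1

end LineGraphs

theorem IsAnalyticSigmoidal.exists_gin_near_gate {σ : ℝ → ℝ} (hσ : IsAnalyticSigmoidal σ) :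
    ∃ η > 0, ∀ {I : Type} [Countable I] {V : I → Type} [∀ i, Fintype (V i)]
      (G : ∀ i, SimpleGraph (V i)) (x : ∀ i, V i → (Fin 1 → ℝ)) {n : ℕ},
      (∀ i, Fintype.card (V i) ≤ n) →
      (∀ i v, ∃ k ∈ ({0, 1} : Set ℝ), |x i v 0 - k| < η) →
      ∃ P : GIN 1 1,
        (∀ i v, ∀ k ∈ ({0, 1} : Set ℝ), |x i v 0 - k| < η →
          |P.eval σ (G i) (x i) v 0 - (1 - 2 * k)| < 1) ∧
        ∀ {i j u v}, P.eval σ (G i) (x i) u = P.eval σ (G j) (x j) v → x i u = x j v := by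
  obtain ⟨r, hr, hout⟩ := hσ.exists_mlp_near_affine (-2) 1 one_pos
  obtain ⟨η, hη, hin⟩ := hσ.exists_mlp_near_affine 1 0 (half_pos hr)
  refine ⟨η, hη, fun {I} _ {V} _ G x {n} hn hx => ?_⟩
  obtain ⟨g, hg, hgk⟩ := hin 1 (countable_jointRange x)
  simp only [one_mul, add_zero] at hgk
  have hbound : ∀ i v, ∀ l : Fin 1, |g.eval σ (x i v) l| ≤ r / 2 + 1 := by
    intro i v l
    obtain ⟨k, hk, hxk⟩ := hx i v
    have hk1 : |k| ≤ 1 := by rcases hk with rfl | rfl <;> simp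
    rw [Subsingleton.elim l 0]
    linarith [abs_sub_abs_le_abs_sub (g.eval σ (x i v) 0) k, hgk _ k hk hxk]
  obtain ⟨ε, hnear, hε⟩ := exists_eps_ginAggregate_near G (fun i v => g.eval σ (x i v)) hn hbound
    (r := r / 2) (by positivity)
  obtain ⟨g', hg', hg'k⟩ := hout (1 + ε)⁻¹
    (countable_jointRange fun i => ginAggregate (G i) ε fun v => g.eval σ (x i v))
  refine ⟨⟨1, g, .one ε g'⟩, fun i v k hk hxk => ?_, fun {i j u v} h => ?_⟩
  · set z := ginAggregate (G i) ε (fun v => g.eval σ (x i v)) v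
    have hz : |(1 + ε)⁻¹ * z 0 - k| < r := by
      linarith [abs_sub_le ((1 + ε)⁻¹ * z 0) (g.eval σ (x i v) 0) k, hnear i v 0, hgk _ k hk hxk]
    have hfinal := hg'k z k hk hz
    rwa [show -2 * k + 1 = 1 - 2 * k by ring] at hfinal
  · exact hg.injOn (mem_jointRange x i u) (mem_jointRange x j v)
      (hε (hg'.injOn (mem_jointRange _ i u) (mem_jointRange _ j v) h))

instance {d : ℕ} : Inhabited (LGVRWeights d) := ⟨⟨default, 0, 0, default, default⟩⟩

theorem phiMap_zero_injective (σ : ℝ → ℝ) (m : MLP 1 1) : Function.Injective (phiMap σ m 0) := by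
  intro p q h
  induction p using Sym2.ind with | _ x y
  induction q using Sym2.ind with | _ x' y'
  simp only [phiMap, Sym2.lift_mk, zero_smul, add_zero] at h
  obtain ⟨hsum, hdiff⟩ := append_eq_append_iff.1 h
  have hsum := congrFun hsum 0
  simp only [Pi.add_apply] at hsum
  have hext : ∀ {a b : Fin 1 → ℝ}, a 0 = b 0 → a = b := fun h => funext fun i => by
    rwa [Subsingleton.elim i 0]
  rw [Sym2.eq_iff]
  rcases abs_eq_abs.1 (congrFun hdiff 0) with h | h
  · exact .inl ⟨hext (by linarith), hext (by linarith)⟩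
  · exact .inr ⟨hext (by linarith), hext (by linarith)⟩

section FiltrationMatrix

variable {V : Type}

/-- A colouring of the edges of `G`, extended by `0` to the virtual edges. -/
noncomputable def extendByZero {α : Type} [Zero α] (G : SimpleGraph V) (x : G.edgeSet → α) :
    (⊤ : SimpleGraph V).edgeSet → α :=
  open Classical in fun e => if h : e.1 ∈ G.edgeSet then x ⟨e.1, h⟩ else 0

theorem extendByZero_of_mem {α : Type} [Zero α] {G : SimpleGraph V} (x : G.edgeSet → α)
    {e : (⊤ : SimpleGraph V).edgeSet} (h : e.1 ∈ G.edgeSet) : extendByZero G x e = x ⟨e.1, h⟩ :=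
  dif_pos h

theorem extendByZero_of_notMem {α : Type} [Zero α] {G : SimpleGraph V} (x : G.edgeSet → α)
    {e : (⊤ : SimpleGraph V).edgeSet} (h : e.1 ∉ G.edgeSet) : extendByZero G x e = 0 :=
  dif_neg h

variable {σ : ℝ → ℝ} {d : ℕ} (θ : LGVRWeights d) [Fintype V] (G : SimpleGraph V)
  (c : V → (Fin d → ℝ))

theorem LGVRWeights.filtrationMatrix_self (u : V) : θ.filtrationMatrix σ G c u u = 0 :=
  dif_pos rfl

theorem LGVRWeights.filtrationMatrix_of_ne {u v : V} (h : u ≠ v) :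
    θ.filtrationMatrix σ G c u v = θ.edgeValue σ G c ⟨s(u, v), h⟩ :=
  dif_neg h

theorem LGVRWeights.filtrationMatrix_symm (u v : V) :
    θ.filtrationMatrix σ G c u v = θ.filtrationMatrix σ G c v u := by
  by_cases h : u = v
  · rw [h]
  · rw [θ.filtrationMatrix_of_ne G c h, θ.filtrationMatrix_of_ne G c (Ne.symm h)]
    exact congrArg _ (Subtype.ext Sym2.eq_swap)

theorem LGVRWeights.filtrationMatrix_pos {u v : V} (h : u ≠ v) :
    0 < θ.filtrationMatrix σ G c u v := by
  rw [θ.filtrationMatrix_of_ne G c h]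
  exact Real.sigmoid_pos _

open Classical in
theorem LGVRWeights.edgeValue_eq (e : (⊤ : SimpleGraph V).edgeSet) :
    θ.edgeValue σ G c e = Real.sigmoid (θ.P₂.eval σ (⊤ : SimpleGraph V).lineGraph
      (extendByZero G (θ.lineColor σ G c)) e 0) := rfl

open Classical in
theorem LGVRWeights.edgeValue_le_half_iff (e : (⊤ : SimpleGraph V).edgeSet) :
    θ.edgeValue σ G c e ≤ 1 / 2 ↔ θ.P₂.eval σ (⊤ : SimpleGraph V).lineGraph
      (extendByZero G (θ.lineColor σ G c)) e 0 ≤ 0 := by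
  rw [edgeValue_eq, one_div, ← Real.sigmoid_zero]
  exact Real.sigmoid_strictMono.le_iff_le

end FiltrationMatrix

/-- On a family of coloured graphs, the filtration matrix stays below the last scale `1/2` exactly
at the edges, and its values at edges determine the colours of the endpoints. -/
structure LGVRWeights.IsFaithful (σ : ℝ → ℝ) {d : ℕ} (θ : LGVRWeights d) {I : Type}
    {V : I → Type} [∀ i, Fintype (V i)] (G : ∀ i, SimpleGraph (V i))
    (c : ∀ i, V i → (Fin d → ℝ)) : Prop where
  le_half_iff_adj {i : I} {u v : V i} (huv : u ≠ v) :
    θ.filtrationMatrix σ (G i) (c i) u v ≤ 1 / 2 ↔ (G i).Adj u v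
  color_eq {i j : I} {u v : V i} {u' v' : V j} (huv : (G i).Adj u v) (huv' : (G j).Adj u' v')
    (h : θ.filtrationMatrix σ (G i) (c i) u v = θ.filtrationMatrix σ (G j) (c j) u' v') :
    s(c i u, c i v) = s(c j u', c j v')

theorem card_edgeSet_le {V : Type} [Fintype V] (G : SimpleGraph V) [Fintype G.edgeSet] :
    Fintype.card G.edgeSet ≤ Fintype.card V * Fintype.card V := by
  rw [← Fintype.card_prod]
  exact (Fintype.card_le_of_injective (Subtype.val : G.edgeSet → Sym2 V)
    Subtype.val_injective).trans (Fintype.card_le_of_surjective _ Sym2.mk_surjective)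

open Classical in
theorem IsAnalyticSigmoidal.exists_isFaithful {σ : ℝ → ℝ} (hσ : IsAnalyticSigmoidal σ)
    {I : Type} [Countable I] {V : I → Type} [∀ i, Fintype (V i)] (G : ∀ i, SimpleGraph (V i))
    (c : ∀ i, V i → (Fin 1 → ℝ)) {n : ℕ} (hn : ∀ i, Fintype.card (V i) ≤ n) :
    ∃ θ : LGVRWeights 1, θ.IsFaithful σ G c := by
  -- The output of `P₁` is close to `1` on the edges of `G`, so the gate recognises them in `P₂`.
  obtain ⟨η, hη, hgate⟩ := hσ.exists_gin_near_gate
  obtain ⟨P₁, hP₁, hP₁inj⟩ := hσ.exists_gin_near_one (fun i => (G i).lineGraph)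
    (fun i e => phiMap σ default 0 (Sym2.map (c i) e.1)) hη
  set y : ∀ i, (G i).edgeSet → (Fin 1 → ℝ) := fun i => P₁.eval σ (G i).lineGraph
    fun e => phiMap σ default 0 (Sym2.map (c i) e.1)
  have hone : ∀ i e, e.1 ∈ (G i).edgeSet → |extendByZero (G i) (y i) e 0 - 1| < η := by
    intro i e he
    rw [extendByZero_of_mem _ he]
    exact hP₁ i _
  have hzero : ∀ i e, e.1 ∉ (G i).edgeSet → |extendByZero (G i) (y i) e 0 - 0| < η := by
    intro i e he
    rwa [extendByZero_of_notMem _ he, Pi.zero_apply, sub_zero, abs_zero]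
  obtain ⟨P₂, hP₂, hP₂inj⟩ := hgate (V := fun i => (⊤ : SimpleGraph (V i)).edgeSet)
    (fun i => (⊤ : SimpleGraph (V i)).lineGraph) (fun i => extendByZero (G i) (y i))
    (fun i => (card_edgeSet_le _).trans (Nat.mul_le_mul (hn i) (hn i))) (fun i e => by
      by_cases he : e.1 ∈ (G i).edgeSet
      · exact ⟨1, .inr rfl, hone i e he⟩
      · exact ⟨0, .inl rfl, hzero i e he⟩)
  refine ⟨⟨default, 0, 1, P₁, P₂⟩, fun {i u v} huv => ?_, fun {i j u v u' v'} huv huv' h => ?_⟩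
  · rw [LGVRWeights.filtrationMatrix_of_ne _ _ _ huv, LGVRWeights.edgeValue_le_half_iff]
    change P₂.eval σ (⊤ : SimpleGraph (V i)).lineGraph (extendByZero (G i) (y i)) _ 0 ≤ 0 ↔ _
    by_cases hadj : (G i).Adj u v
    · have hneg := abs_lt.1 (hP₂ i ⟨s(u, v), huv⟩ 1 (.inr rfl) (hone i _ hadj))
      exact iff_of_true (by linarith) hadj
    · have hpos := abs_lt.1 (hP₂ i ⟨s(u, v), huv⟩ 0 (.inl rfl) (hzero i _ hadj))
      exact iff_of_false (by linarith) hadj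
  · rw [LGVRWeights.filtrationMatrix_of_ne _ _ _ huv.ne,
      LGVRWeights.filtrationMatrix_of_ne _ _ _ huv'.ne, LGVRWeights.edgeValue_eq,
      LGVRWeights.edgeValue_eq, Real.sigmoid_strictMono.injective.eq_iff] at h
    have hcolor : extendByZero (G i) (y i) ⟨s(u, v), huv.ne⟩ =
        extendByZero (G j) (y j) ⟨s(u', v'), huv'.ne⟩ :=
      hP₂inj (funext fun k => Subsingleton.elim 0 k ▸ h)
    rw [extendByZero_of_mem _ ((G i).mem_edgeSet.2 huv),
      extendByZero_of_mem _ ((G j).mem_edgeSet.2 huv')] at hcolor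
    simpa only [Sym2.map_mk] using phiMap_zero_injective σ default (hP₁inj hcolor)

theorem diagramPoint_injOn : Set.InjOn diagramPoint {p | p.2 ≠ 1} := by
  rintro ⟨b, d⟩ hp ⟨b', d'⟩ hq h
  obtain rfl : b = b' := congrFun h 0
  have hd : d.untopD 1 = d'.untopD 1 := congrFun h 1
  cases d <;> cases d' <;> simp_all [eq_comm]

instance {n : ℕ} : Inhabited (SetEncoder n) := ⟨⟨0, 0, default, default, default⟩⟩

theorem IsAnalyticSigmoidal.exists_setEncoder {σ : ℝ → ℝ} (hσ : IsAnalyticSigmoidal σ)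
    {I : Type} [Countable I] (D : I → Multiset (ℝ × WithTop ℝ) × Multiset (ℝ × WithTop ℝ))
    (hD : ∀ i, ∀ p ∈ (D i).1 + (D i).2, p.2 ≠ 1) :
    ∃ S : SetEncoder 1, ∀ i j, S.eval σ (D i) = S.eval σ (D j) → D i = D j := by
  classical
  let P : Set (ℝ × WithTop ℝ) := ⋃ i, {p | p ∈ (D i).1 + (D i).2}
  have hP : P.Countable := Set.countable_iUnion fun i =>
    ((D i).1 + (D i).2).toFinset.countable_toSet.mono fun p hp => by simpa using hp
  have hPinj : Set.InjOn diagramPoint P := diagramPoint_injOn.mono (Set.iUnion_subset hD)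
  have hmem₀ : ∀ i, ∀ p ∈ (D i).1, p ∈ P := fun i p hp =>
    Set.mem_iUnion.2 ⟨i, Multiset.mem_add.2 (.inl hp)⟩
  have hmem₁ : ∀ i, ∀ p ∈ (D i).2, p ∈ P := fun i p hp =>
    Set.mem_iUnion.2 ⟨i, Multiset.mem_add.2 (.inr hp)⟩
  obtain ⟨S, hS⟩ := hσ.exists_mlp_sumInjOn (hP.image diagramPoint)
  have hSP := hS.comp hPinj
  obtain ⟨m, hm⟩ := hσ.exists_mlp_sumInjOn (Set.countable_range fun i =>
    Fin.append (((D i).1.map fun p => S.eval σ (diagramPoint p)).sum)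
      (((D i).2.map fun p => S.eval σ (diagramPoint p)).sum))
  refine ⟨⟨1, 1, S, S, m⟩, fun i j h => ?_⟩
  obtain ⟨h₀, h₁⟩ := append_eq_append_iff.1 (hm.injOn ⟨i, rfl⟩ ⟨j, rfl⟩ h)
  exact Prod.ext (hSP (hmem₀ i) (hmem₀ j) h₀) (hSP (hmem₁ i) (hmem₁ j) h₁)

/-! ### Edges, degrees and isolated nodes -/

section Darts

variable {V V' E : Type} [Fintype V] [Fintype V'] {G : SimpleGraph V} {G' : SimpleGraph V'}

open Classical in
theorem card_nbrs_eq_degree (u : V) : (nbrs G u).card = G.degree u := by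
  rw [← G.card_neighborFinset_eq_degree, G.neighborFinset_eq_filter]
  rfl

open Classical in
theorem card_filter_dart_fst (u : V) :
    (Finset.univ.filter fun e : G.Dart => e.fst = u).card = (nbrs G u).card := by
  rw [card_nbrs_eq_degree, ← G.dart_fst_fiber_card_eq_degree u]

open Classical in
theorem two_mul_sum_card_nbrs (c : V → E) (κ : E) :
    2 * ∑ u with c u = κ, (nbrs G u).card =
      ∑ e : G.Dart, ((if c e.fst = κ then 1 else 0) + if c e.snd = κ then 1 else 0) := by
  have hfst : ∑ e : G.Dart, (if c e.fst = κ then 1 else 0) =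
      ∑ u with c u = κ, (nbrs G u).card := by
    rw [Finset.sum_filter, ← Finset.sum_fiberwise Finset.univ fun e : G.Dart => e.fst]
    refine Finset.sum_congr rfl fun u _ => ?_
    rw [Finset.sum_congr rfl fun e he => by rw [(Finset.mem_filter.1 he).2], Finset.sum_const,
      card_filter_dart_fst, smul_eq_mul, mul_ite, mul_one, mul_zero]
  have hsnd : ∑ e : G.Dart, (if c e.snd = κ then 1 else 0) =
      ∑ e : G.Dart, (if c e.fst = κ then 1 else 0) :=
    Fintype.sum_equiv SimpleGraph.Dart.symm_involutive.toPerm _ _ fun _ => rfl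
  rw [Finset.sum_add_distrib, hsnd, hfst, two_mul]

theorem card_nbrs_pos_iff {u : V} : 0 < (nbrs G u).card ↔ u ∈ G.support := by
  rw [Multiset.card_pos, Ne, nbrs_eq_zero_iff, not_not]

open Classical in
theorem mul_count_map_support {c : V → E} {κ : E} {k : ℕ} (hk : 0 < k)
    (hdeg : ∀ u, c u = κ → (nbrs G u).card = k) :
    k * (G.support.toFinset.val.map c).count κ = ∑ u with c u = κ, (nbrs G u).card := by
  have hsupp : (G.support.toFinset.filter fun u => κ = c u) = Finset.univ.filter (c · = κ) := by
    ext u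
    simp only [Finset.mem_filter, Set.mem_toFinset, Finset.mem_univ, true_and, eq_comm (a := κ),
      and_iff_right_iff_imp]
    exact fun hu => card_nbrs_pos_iff.1 (hdeg u hu ▸ hk)
  rw [Finset.sum_const_nat fun u hu => hdeg u (Finset.mem_filter.1 hu).2, Multiset.count_map,
    ← Finset.filter_val, Finset.card_val, hsupp, mul_comm]

open Classical in
theorem map_support_eq_of_map_darts_eq {c : V → E} {c' : V' → E} {k : E → ℕ}
    (hk : ∀ u, (nbrs G u).card = k (c u)) (hk' : ∀ u, (nbrs G' u).card = k (c' u))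
    (h : (Finset.univ : Finset G.Dart).val.map (fun e => s(c e.fst, c e.snd)) =
      (Finset.univ : Finset G'.Dart).val.map (fun e => s(c' e.fst, c' e.snd))) :
    G.support.toFinset.val.map c = G'.support.toFinset.val.map c' := by
  ext κ
  rcases Nat.eq_zero_or_pos (k κ) with hκ | hκ
  · rw [Multiset.count_eq_zero_of_notMem, Multiset.count_eq_zero_of_notMem]
    · simp only [Multiset.mem_map, Finset.mem_val, Set.mem_toFinset, not_exists, not_and]
      rintro u hu rfl
      exact (card_nbrs_pos_iff.2 hu).ne' ((hk' u).trans hκ)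
    · simp only [Multiset.mem_map, Finset.mem_val, Set.mem_toFinset, not_exists, not_and]
      rintro u hu rfl
      exact (card_nbrs_pos_iff.2 hu).ne' ((hk u).trans hκ)
  · have hsum : ∑ u with c u = κ, (nbrs G u).card = ∑ u with c' u = κ, (nbrs G' u).card := by
      refine Nat.eq_of_mul_eq_mul_left two_pos ?_
      rw [two_mul_sum_card_nbrs, two_mul_sum_card_nbrs]
      refine congrArg Multiset.sum (map_eq_map_of_forall_imp (fun e _ e' _ he => ?_) h)
      rcases Sym2.eq_iff.1 he with ⟨h₁, h₂⟩ | ⟨h₁, h₂⟩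
      · rw [h₁, h₂]
      · rw [h₁, h₂, add_comm]
    refine Nat.eq_of_mul_eq_mul_left hκ ?_
    rw [mul_count_map_support hκ fun u hu => (hk u).trans (congrArg k hu),
      mul_count_map_support hκ fun u hu => (hk' u).trans (congrArg k hu), hsum]

theorem map_univ_eq_of_map_eq {S : Finset V} {S' : Finset V'}
    {f : V → E} {f' : V' → E} (hcard : Fintype.card V = Fintype.card V')
    (h : S.val.map f = S'.val.map f') (hcompl : ∀ u ∉ S, ∀ v ∉ S', f u = f' v) :
    (Finset.univ : Finset V).val.map f = (Finset.univ : Finset V').val.map f' := by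
  classical
  have hS : S.card = S'.card := by simpa using congrArg Multiset.card h
  have hSc : Sᶜ.val.map f = S'ᶜ.val.map f' :=
    map_eq_map_of_forall_imp (f := fun _ => ()) (f' := fun _ => ())
      (fun u hu v hv _ => hcompl u (Finset.mem_compl.1 hu) v (Finset.mem_compl.1 hv)) (by
        rw [Multiset.map_const', Multiset.map_const', Finset.card_val, Finset.card_val,
          Finset.card_compl, Finset.card_compl, hS, hcard])
  have hsplit : ∀ {W : Type} [Fintype W] [DecidableEq W] (R : Finset W),
      (Finset.univ : Finset W).val = R.val + Rᶜ.val := fun R => by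
    rw [Finset.compl_eq_univ_sdiff, Finset.sdiff_val,
      add_tsub_cancel_of_le (Finset.val_le_iff.2 R.subset_univ)]
  rw [hsplit S, hsplit S', Multiset.map_add, Multiset.map_add, h, hSc]

theorem card_connectedComponent_eq_one_iff {V : Type} {G : SimpleGraph V} :
    Nat.card G.ConnectedComponent = 1 ↔ G.Connected := by
  rw [Nat.card_eq_one_iff_unique, SimpleGraph.connected_iff]
  constructor
  · rintro ⟨_, ⟨κ⟩⟩
    exact ⟨fun u v => SimpleGraph.ConnectedComponent.exact (Subsingleton.elim _ _),
      ⟨κ.out⟩⟩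
  · rintro ⟨hG, ⟨v⟩⟩
    exact ⟨hG.subsingleton_connectedComponent, ⟨G.connectedComponentMk v⟩⟩

end Darts

namespace LGVRWeights

variable {σ : ℝ → ℝ} {d : ℕ} {θ : LGVRWeights d}

theorem diagram_snd_ne_one {V : Type} [Fintype V] (G : SimpleGraph V) (c : V → (Fin d → ℝ)) :
    ∀ p ∈ (θ.diagram σ G c).1 + (θ.diagram σ G c).2, p.2 ≠ 1 := by
  rintro ⟨b, _⟩ hp rfl
  have hscale : (1 : ℝ) ∈ criticalScales (θ.filtrationMatrix σ G c) (1 / 2) :=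
    (Multiset.mem_add.1 hp).elim mem_criticalScales_of_mem_persistenceDiagram
      mem_criticalScales_of_mem_persistenceDiagram
  have := (mem_criticalScales.1 hscale).2
  norm_num at this

theorem card_eq_of_diagram_eq {V V' : Type} [Fintype V] [Fintype V'] {G : SimpleGraph V}
    {G' : SimpleGraph V'} {c : V → (Fin d → ℝ)} {c' : V' → (Fin d → ℝ)}
    (h : θ.diagram σ G c = θ.diagram σ G' c') : Fintype.card V = Fintype.card V' := by
  have hr : (0 : ℝ) ≤ 1 / 2 := by norm_num
  rw [← card_persistenceDiagram_zero (θ.filtrationMatrix_self G c)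
      (fun _ _ => θ.filtrationMatrix_pos (σ := σ) G c) hr,
    ← card_persistenceDiagram_zero (θ.filtrationMatrix_self G' c')
      (fun _ _ => θ.filtrationMatrix_pos (σ := σ) G' c') hr]
  exact congrArg (fun D => Multiset.card D.1) h

namespace IsFaithful

variable {I : Type} {V : I → Type} [∀ i, Fintype (V i)] {G : ∀ i, SimpleGraph (V i)}
  {c : ∀ i, V i → (Fin d → ℝ)} (h : θ.IsFaithful σ G c)
include h

open Classical in
theorem count_map_darts (i : I) (t : ℝ) :
    ((Finset.univ : Finset (G i).Dart).val.map fun e =>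
        θ.filtrationMatrix σ (G i) (c i) e.fst e.snd).count t =
      if 0 < t ∧ t ≤ 1 / 2 then
        2 * ((θ.diagram σ (G i) (c i)).1.count (0, (t : WithTop ℝ)) +
          (θ.diagram σ (G i) (c i)).2.count (t, ⊤))
      else 0 := by
  set M := θ.filtrationMatrix σ (G i) (c i)
  rw [Multiset.count_map, ← Finset.filter_val, Finset.card_val]
  split_ifs with ht
  · refine Eq.trans ?_ (two_mul_count_persistenceDiagram (θ.filtrationMatrix_self (G i) (c i))
      (θ.filtrationMatrix_symm (G i) (c i)) ht.1 ht.2).symm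
    refine Finset.card_bij (fun e _ => e.toProd) (fun e he => ?_)
      (fun e _ e' _ hee => SimpleGraph.Dart.toProd_injective hee) (fun p hp => ?_)
    · exact Finset.mem_filter.2 ⟨Finset.mem_univ _, e.adj.ne, (Finset.mem_filter.1 he).2.symm⟩
    · obtain ⟨-, hne, hpt⟩ := Finset.mem_filter.1 hp
      exact ⟨⟨p, (h.le_half_iff_adj hne).1 (hpt.trans_le ht.2)⟩,
        Finset.mem_filter.2 ⟨Finset.mem_univ _, hpt.symm⟩, rfl⟩
  · refine Finset.card_eq_zero.2 (Finset.filter_eq_empty_iff.2 ?_)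
    rintro e - rfl
    exact ht ⟨θ.filtrationMatrix_pos _ _ e.adj.ne, (h.le_half_iff_adj e.adj.ne).2 e.adj⟩

open Classical in
theorem map_darts_eq_of_diagram_eq {i j : I}
    (hD : θ.diagram σ (G i) (c i) = θ.diagram σ (G j) (c j)) :
    (Finset.univ : Finset (G i).Dart).val.map (fun e => s(c i e.fst, c i e.snd)) =
      (Finset.univ : Finset (G j).Dart).val.map (fun e => s(c j e.fst, c j e.snd)) := by
  refine map_eq_map_of_forall_imp (fun e _ e' _ => h.color_eq e.adj e'.adj) (Multiset.ext.2 ?_)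
  intro t
  rw [h.count_map_darts, h.count_map_darts, hD]

theorem edgeGraph_vrSkeleton_eq (i : I) :
    edgeGraph (vrSkeleton (θ.filtrationMatrix σ (G i) (c i)) (Set.Iic (1 / 2))) = G i := by
  ext u v
  rw [edgeGraph_vrSkeleton_adj (θ.filtrationMatrix_self (G i) (c i))
    (θ.filtrationMatrix_symm (G i) (c i)) (by norm_num)]
  exact ⟨fun huv => (h.le_half_iff_adj huv.1).1 huv.2,
    fun huv => ⟨huv.ne, (h.le_half_iff_adj huv.ne).2 huv⟩⟩

theorem count_zero_top_diagram (i : I) [Nonempty (V i)] :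
    (θ.diagram σ (G i) (c i)).1.count (0, ⊤) = Nat.card (G i).ConnectedComponent := by
  have hcount := count_zero_top_persistenceDiagram (θ.filtrationMatrix_self (σ := σ) (G i) (c i))
    (r := 1 / 2) (by norm_num)
  rwa [h.edgeGraph_vrSkeleton_eq] at hcount

theorem connected_iff_of_diagram_eq {i j : I} [Nonempty (V i)] [Nonempty (V j)]
    (hD : θ.diagram σ (G i) (c i) = θ.diagram σ (G j) (c j)) :
    (G i).Connected ↔ (G j).Connected := by
  rw [← card_connectedComponent_eq_one_iff, ← card_connectedComponent_eq_one_iff,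
    ← h.count_zero_top_diagram, ← h.count_zero_top_diagram, hD]

theorem map_univ_eq_of_diagram_eq {E : Type} {f : ∀ i, V i → E} {k : E → ℕ}
    (hf : ∀ {i j u v}, c i u = c j v → f i u = f j v)
    (hk : ∀ i u, (nbrs (G i) u).card = k (f i u)) {i j : I}
    (hiso : ∀ u ∉ (G i).support, ∀ v ∉ (G j).support, f i u = f j v)
    (hD : θ.diagram σ (G i) (c i) = θ.diagram σ (G j) (c j)) :
    (Finset.univ : Finset (V i)).val.map (f i) = (Finset.univ : Finset (V j)).val.map (f j) := by
  classical
  refine map_univ_eq_of_map_eq (card_eq_of_diagram_eq hD)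
    (map_support_eq_of_map_darts_eq (hk i) (hk j) ?_) ?_
  · refine map_eq_map_of_forall_imp (fun e _ e' _ he => ?_) (h.map_darts_eq_of_diagram_eq hD)
    rcases Sym2.eq_iff.1 he with ⟨h₁, h₂⟩ | ⟨h₁, h₂⟩
    · rw [hf h₁, hf h₂]
    · rw [hf h₁, hf h₂, Sym2.eq_swap]
  · simpa only [Set.mem_toFinset] using hiso

end IsFaithful

end LGVRWeights

/-! ### The three models -/

/-- Two disjoint triangles, the residue classes modulo `2`. Like the cycle of length six, this graph
is `2`-regular, but it is not connected. -/
def twoTriangles : SimpleGraph (Fin 6) where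
  Adj i j := i ≠ j ∧ i.val % 2 = j.val % 2
  symm := ⟨fun _ _ h => ⟨h.1.symm, h.2.symm⟩⟩
  loopless := ⟨by decide⟩

instance : DecidableRel twoTriangles.Adj := fun i j =>
  inferInstanceAs (Decidable (i ≠ j ∧ i.val % 2 = j.val % 2))

theorem card_nbrs_cycleGraph_six (u : Fin 6) : (nbrs (SimpleGraph.cycleGraph 6) u).card = 2 := by
  rw [card_nbrs_eq_degree]
  convert SimpleGraph.cycleGraph_degree_three_le

theorem card_nbrs_twoTriangles (u : Fin 6) : (nbrs twoTriangles u).card = 2 := by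
  have hdegree : ∀ u, twoTriangles.degree u = 2 := by decide
  rw [card_nbrs_eq_degree, ← hdegree u]
  congr!

theorem not_connected_twoTriangles : ¬ twoTriangles.Connected := by
  intro h
  obtain ⟨p⟩ := h.preconnected 0 1
  have hparity : ∀ {i j : Fin 6}, twoTriangles.Walk i j → i.val % 2 = j.val % 2 := by
    intro i j p
    induction p with
    | nil => rfl
    | cons h _ ih => exact h.2.trans ih
  exact absurd (hparity p) (by decide)

/-- The graph `G` with all node features equal to `c`. -/
def constGraph {N k : ℕ} (G : SimpleGraph (Fin k)) (c : Fin N → ℝ) : FGraph N := ⟨k, G, fun _ => c⟩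

theorem not_wlDistinguishes_constGraph {N k d : ℕ} {G H : SimpleGraph (Fin k)}
    (hG : ∀ u, (nbrs G u).card = d) (hH : ∀ u, (nbrs H u).card = d) (c : Fin N → ℝ) :
    ¬ WLDistinguishes (constGraph G c) (constGraph H c) := by
  rintro ⟨t, ht⟩
  exact ht (Multiset.map_congr rfl fun u _ => wlColor_eq_of_regular hG hH (fun _ _ => rfl) t u u)

theorem noIsolated_constGraph {N k d : ℕ} (hd : 0 < d) {G : SimpleGraph (Fin k)}
    (hG : ∀ u, (nbrs G u).card = d) (c : Fin N → ℝ) : (constGraph G c).NoIsolated := fun u =>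
  (card_nbrs_pos_iff (G := G)).1 (hG u ▸ hd)

theorem countable_boundedGraphs {N : ℕ} {χ : Set (Fin N → ℝ)} (hχ : χ.Countable) (n : ℕ) :
    (boundedGraphs χ n).Countable := by
  have := hχ.to_subtype
  refine (Set.countable_range fun p : Σ k : ℕ, SimpleGraph (Fin k) × (Fin k → χ) =>
    (⟨p.1, p.2.1, fun v => (p.2.2 v).1⟩ : FGraph N)).mono fun G hG => ?_
  exact ⟨⟨G.order, G.graph, fun v => ⟨G.feat v, hG.2 v⟩⟩, rfl⟩

theorem exists_eps_add {I E : Type} [Countable I] [AddCommGroup E] [Module ℝ E] (x y : I → E) :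
    ∃ ε : ℝ, ∀ i j, x i + (1 + ε) • y i = x j + (1 + ε) • y j → x i = x j ∧ y i = y j := by
  obtain ⟨t, -, -, ht⟩ := exists_smul_add_injOn (Set.countable_range fun i => (y i, x i))
    zero_lt_one
  refine ⟨t - 1, fun i j h => ?_⟩
  simp only [add_sub_cancel, add_comm (x _)] at h
  exact (Prod.mk_inj.1 (ht ⟨i, rfl⟩ ⟨j, rfl⟩ h)).symm

section Models

variable {σ : ℝ → ℝ} {N n : ℕ} {𝒢 : Set (FGraph N)}

theorem diagram_cycleGraph_ne {θ : LGVRWeights 1} {c : ∀ i : 𝒢, Fin i.1.order → (Fin 1 → ℝ)}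
    (hθ : θ.IsFaithful σ (fun i : 𝒢 => i.1.graph) c) {a : Fin N → ℝ}
    (h₁ : constGraph (SimpleGraph.cycleGraph 6) a ∈ 𝒢) (h₂ : constGraph twoTriangles a ∈ 𝒢) :
    θ.diagram σ (SimpleGraph.cycleGraph 6) (c ⟨_, h₁⟩) ≠
      θ.diagram σ twoTriangles (c ⟨_, h₂⟩) := by
  intro h
  have : Nonempty (Fin (constGraph (SimpleGraph.cycleGraph 6) a).order) := ⟨(0 : Fin 6)⟩
  have : Nonempty (Fin (constGraph twoTriangles a).order) := ⟨(0 : Fin 6)⟩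
  exact not_connected_twoTriangles ((hθ.connected_iff_of_diagram_eq
    (i := ⟨_, h₁⟩) (j := ⟨_, h₂⟩) h).1 SimpleGraph.cycleGraph_connected)

variable (hσ : IsAnalyticSigmoidal σ) (h𝒢 : 𝒢.Countable) (hn : ∀ G ∈ 𝒢, G.order ≤ n)
include hσ h𝒢 hn

theorem IsAnalyticSigmoidal.ginlgvr_strictlyMorePowerful
    (hiso : ∀ G ∈ 𝒢, ∀ H ∈ 𝒢, ∀ u ∉ G.graph.support, ∀ v ∉ H.graph.support, G.feat u = H.feat v)
    {a : Fin N → ℝ} (h₁ : constGraph (SimpleGraph.cycleGraph 6) a ∈ 𝒢)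
    (h₂ : constGraph twoTriangles a ∈ 𝒢) :
    StrictlyMorePowerful (GINLGVR.rep σ) WLDistinguishes 𝒢 := by
  have := h𝒢.to_subtype
  obtain ⟨g, -, hg⟩ := hσ.exists_gin (V := fun i : 𝒢 => Fin i.1.order)
    (fun i => i.1.graph) (n * n) fun i => i.1.feat
  obtain ⟨θ, hθ⟩ := hσ.exists_isFaithful (V := fun i : 𝒢 => Fin i.1.order) (fun i => i.1.graph)
    (fun i => g.eval σ i.1.graph i.1.feat) fun i => (Fintype.card_fin _).trans_le (hn i i.2)
  obtain ⟨S, hS⟩ := hσ.exists_setEncoder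
    (fun i : 𝒢 => θ.diagram σ i.1.graph (g.eval σ i.1.graph i.1.feat))
    fun i => LGVRWeights.diagram_snd_ne_one _ _
  refine ⟨⟨1, 1, g, θ, S⟩, fun G hG H hH htest hrep => ?_, _, h₁, _, h₂,
    not_wlDistinguishes_constGraph card_nbrs_cycleGraph_six card_nbrs_twoTriangles a,
    fun hrep => diagram_cycleGraph_ne hθ h₁ h₂ (hS ⟨_, h₁⟩ ⟨_, h₂⟩ hrep)⟩
  refine not_wlDistinguishes (T := n * n + 1)
    (Nat.le_succ_of_le (Nat.mul_le_mul (hn G hG) (hn H hH))) ?_ htest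
  exact hθ.map_univ_eq_of_diagram_eq (i := ⟨G, hG⟩) (j := ⟨H, hH⟩)
    (k := fun κ : WLColor _ (n * n + 1) => Multiset.card κ.2) hg
    (fun i u => (card_snd_wlColor_succ _ _ u).symm)
    (fun u hu v hv => wlColor_eq_of_isolated hu hv (hiso G hG H hH u hu v hv) _)
    (hS ⟨G, hG⟩ ⟨H, hH⟩ hrep)

theorem IsAnalyticSigmoidal.ginlgvrPlus_strictlyMorePowerful {a : Fin N → ℝ}
    (h₁ : constGraph (SimpleGraph.cycleGraph 6) a ∈ 𝒢) (h₂ : constGraph twoTriangles a ∈ 𝒢) :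
    StrictlyMorePowerful (GINLGVRPlus.rep σ) WLDistinguishes 𝒢 := by
  have := h𝒢.to_subtype
  obtain ⟨g, hg, hgwl⟩ := hσ.exists_gin (V := fun i : 𝒢 => Fin i.1.order)
    (fun i => i.1.graph) (n * n) fun i => i.1.feat
  obtain ⟨θ, hθ⟩ := hσ.exists_isFaithful (V := fun i : 𝒢 => Fin i.1.order) (fun i => i.1.graph)
    (fun i => g.eval σ i.1.graph i.1.feat) fun i => (Fintype.card_fin _).trans_le (hn i i.2)
  obtain ⟨S, hS⟩ := hσ.exists_setEncoder
    (fun i : 𝒢 => θ.diagram σ i.1.graph (g.eval σ i.1.graph i.1.feat))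
    fun i => LGVRWeights.diagram_snd_ne_one _ _
  obtain ⟨ε, hε⟩ := exists_eps_add
    (fun i : 𝒢 => S.eval σ (θ.diagram σ i.1.graph (g.eval σ i.1.graph i.1.feat)))
    (fun i : 𝒢 => ∑ u, g.eval σ i.1.graph i.1.feat u)
  refine ⟨⟨1, g, θ, S, ε⟩, fun G hG H hH htest hrep => ?_, _, h₁, _, h₂,
    not_wlDistinguishes_constGraph card_nbrs_cycleGraph_six card_nbrs_twoTriangles a, fun hrep =>
      diagram_cycleGraph_ne hθ h₁ h₂ (hS ⟨_, h₁⟩ ⟨_, h₂⟩ (hε ⟨_, h₁⟩ ⟨_, h₂⟩ hrep).1)⟩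
  refine not_wlDistinguishes (T := n * n + 1)
    (Nat.le_succ_of_le (Nat.mul_le_mul (hn G hG) (hn H hH))) ?_ htest
  exact map_eq_map_of_forall_imp (fun _ _ _ _ => hgwl (i := ⟨G, hG⟩) (j := ⟨H, hH⟩))
    (map_eq_map_of_sum_eq hg (hε ⟨G, hG⟩ ⟨H, hH⟩ hrep).2)

theorem IsAnalyticSigmoidal.ppgnlgvrPlus_atLeastAsPowerful :
    AtLeastAsPowerful (PPGNLGVRPlus.rep σ) (KWLDistinguishes 3) 𝒢 := by
  have := h𝒢.to_subtype
  obtain ⟨P, hP⟩ := hσ.exists_ppgn (V := fun i : 𝒢 => Fin i.1.order) (n ^ 3 * n ^ 3 + 3)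
    fun i => ppgnInput i.1.graph i.1.feat
  let weights (ε : ℝ) : PPGNLGVRPlus N := ⟨2, P, default, default, ε⟩
  obtain ⟨ε, hε⟩ := exists_eps_add
    (fun i : 𝒢 => (weights 0).enc.eval σ
      ((weights 0).lgvr.diagram σ i.1.graph ((weights 0).nodeColor σ i)))
    (fun i : 𝒢 => ∑ u, (weights 0).nodeColor σ i u)
  refine ⟨weights ε, fun G hG H hH htest hrep => ?_⟩
  refine not_kwlDistinguishes (T := n ^ 3 * n ^ 3) ?_ ?_ htest
  · have := hn G hG
    have := hn H hH
    gcongr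
  · exact map_kwlColor_eq_of_folkloreColor
      (hP ⟨G, hG⟩ ⟨H, hH⟩ (hε ⟨G, hG⟩ ⟨H, hH⟩ hrep).2)

end Models

theorem constGraph_mem_boundedGraphs {N n k : ℕ} {χ : Set (Fin N → ℝ)} (hk : k ≤ n)
    {c : Fin N → ℝ} (hc : c ∈ χ) (G : SimpleGraph (Fin k)) : constGraph G c ∈ boundedGraphs χ n :=
  ⟨hk, fun _ => hc⟩

theorem corollary6p3 (σ : ℝ → ℝ) (hσ : IsAnalyticSigmoidal σ) (N : ℕ) (χ : Set (Fin N → ℝ))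
    (hχ : χ.Countable) (h0 : 0 ∈ χ) (n : ℕ) (hn : 6 ≤ n) :
    ((∀ c ∈ χ, StrictlyMorePowerful (GINLGVR.rep σ) WLDistinguishes
          {G ∈ boundedGraphs χ n | ∀ v, G.feat v = c}) ∧
      StrictlyMorePowerful (GINLGVR.rep σ) WLDistinguishes
          {G ∈ boundedGraphs χ n | G.NoIsolated}) ∧
    StrictlyMorePowerful (GINLGVRPlus.rep σ) WLDistinguishes (boundedGraphs χ n) ∧
    AtLeastAsPowerful (PPGNLGVRPlus.rep σ) (KWLDistinguishes 3) (boundedGraphs χ n) := by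
  have hcount := countable_boundedGraphs hχ n
  have hmem : ∀ {c}, c ∈ χ → ∀ G, constGraph G c ∈ boundedGraphs χ n :=
    constGraph_mem_boundedGraphs hn
  refine ⟨⟨fun c hc => ?_, ?_⟩, ?_, ?_⟩
  · exact hσ.ginlgvr_strictlyMorePowerful (hcount.mono fun _ h => h.1) (fun _ h => h.1.1)
      (fun G hG H hH u _ v _ => (hG.2 u).trans (hH.2 v).symm)
      ⟨hmem hc _, fun _ => rfl⟩ ⟨hmem hc _, fun _ => rfl⟩
  · exact hσ.ginlgvr_strictlyMorePowerful (hcount.mono fun _ h => h.1) (fun _ h => h.1.1)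
      (fun G hG _ _ u hu _ _ => absurd (hG.2 u) hu)
      ⟨hmem h0 _, noIsolated_constGraph two_pos card_nbrs_cycleGraph_six 0⟩
      ⟨hmem h0 _, noIsolated_constGraph two_pos card_nbrs_twoTriangles 0⟩
  · exact hσ.ginlgvrPlus_strictlyMorePowerful hcount (fun _ h => h.1) (hmem h0 _) (hmem h0 _)
  · exact hσ.ppgnlgvrPlus_atLeastAsPowerful hcount fun _ h => h.1
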